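/- Let $m,n,q\ge 0$, let $|\Omega|\subset\mathbb{R}^m$ be open, and let $\mathcal{N}$ be a smooth manifold of dimension $n$ (Hausdorff, second countable, without boundary). Let $\mathbb{R}[\eta^1,\dots,\eta^q]$ be the real Grassmann algebra on anticommuting generators $\eta^1,\dots,\eta^q$, let $\mathbb{R}[\eta^1,\dots,\eta^q]^0$ be its even part, and let $\mathcal{C}^\infty(|\Omega|\times\mathbb{R}^{0|q})^0:=\mathcal{C}^\infty(|\Omega|)\otimes\mathbb{R}[\eta^1,\dots,\eta^q]^0$. Let $\mathbb{I}^q_2$ be the set of multi-indices $I=(i_1<\dots<i_{2j})$ in $\{1,\dots,q\}$ of even length $2j\ge 2$, and put $\eta^I:=\eta^{i_1}\cdots\eta^{i_{2j}}$. Morphisms of algebras are $\mathbb{R}$-linear, multiplicative and send $1$ to $1$. Let $\varphi:|\Omega|\to\mathcal{N}$ be smooth, let $U\subset|\Omega|\times\mathcal{N}$ be an open set containing the graph of $\varphi$, and for each $I\in\mathbb{I}^q_2$ let $\xi_I$ be a smooth section over $U$ of $\pi^*T\mathcal{N}$, where $\pi:|\Omega|\times\mathcal{N}\to\mathcal{N}$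 is the projection; that is, $\xi_I$ is a family of vector fields $(\xi_I)_x$ on the slices $U_x=\{p\in\mathcal{N}: (x,p)\in U\}$, depending smoothly on $x$. It acts on $g\in\mathcal{C}^\infty(U)$ by $(\xi_I g)(x,p)=\big((\xi_I)_x\, g(x,\cdot)\big)(p)$. Let $\Xi=\sum_{I\in\mathbb{I}^q_2}\xi_I\eta^I$, acting on $\mathcal{C}^\infty(U)\otimes\mathbb{R}[\eta^1,\dots,\eta^q]^0$ by $\Xi(g\,\eta^J)=\sum_I(\xi_I g)\,\eta^I\eta^J$, and let $e^\Xi=\sum_{k=0}^{[q/2]}\Xi^k/k!$. For $f\in\mathcal{C}^\infty(\mathcal{N})$ let $(1\times\varphi)^*(e^\Xi f)$ denote the pull-back of $e^\Xi(f\circ\pi)$ by $x\mapsto(x,\varphi(x))$, i.e. $x\mapsto(e^{\Xi_x}f)(\varphi(x))$. 1. For all such $\varphi$, $U$ and $(\xi_I)_I$, the map $f\mapsto(1\times\varphi)^*(e^\Xi f)$ is a morphism of algebras $\mathcal{C}^\infty(\mathcal{N})\to\mathcal{C}^\infty(|\Omega|\times\mathbb{R}^{0|q})^0$. 2. Conversely,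 for every morphism of algebras $\Phi^*:\mathcal{C}^\infty(\mathcal{N})\to\mathcal{C}^\infty(|\Omega|\times\mathbb{R}^{0|q})^0$ there is a smooth map $\varphi:|\Omega|\to\mathcal{N}$ such that: (a) there are an open neighbourhood $U$ of the graph of $\varphi$ in $|\Omega|\times\mathcal{N}$ and smooth sections $\xi_I$ of $\pi^*T\mathcal{N}$ over $U$, for $I\in\mathbb{I}^q_2$, with $\Phi^*f=(1\times\varphi)^*(e^\Xi f)$ for all $f\in\mathcal{C}^\infty(\mathcal{N})$, and with $[(\xi_I)_x,(\xi_J)_x]=0$ on $U_x$ for all $I,J$ and all $x\in|\Omega|$; (b) if the image of $\varphi$ is contained in the domain $V$ of a single coordinate chart $y=(y^1,\dots,y^n):V\to\mathbb{R}^n$ of $\mathcal{N}$, then $U$ and the $\xi_I$ in (a) can moreover be chosen so that $U\subset|\Omega|\times V$ and $\xi_I\,\xi_J\,y^i=0$ on $U$ for all $I,J$ and all $i$. -/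

import Mathlib

open scoped Manifold ContDiff TensorProduct
open TopologicalSpace

noncomputable section

namespace SuperMap

/-! ### The Grassmann algebra and its even part -/

/-- The even part `ℝ[η¹, …, η^q]⁰` of the real Grassmann (exterior) algebra on `q` generators;
Mathlib's exterior algebra is the Clifford algebra of the zero quadratic form. -/
abbrev EvenGrassmann (q : ℕ) : Type :=
  CliffordAlgebra.even (0 : QuadraticForm ℝ (Fin q → ℝ))

/-- The odd generator `η^i`. -/
def eta (q : ℕ) (i : Fin q) : ExteriorAlgebra ℝ (Fin q → ℝ) :=
  ExteriorAlgebra.ι ℝ (Pi.single i 1)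

/-- The multi-indices `i₁ < ⋯ < i_j` of even positive length `j`, given by their sets of
entries. -/
abbrev EvenIndex (q : ℕ) : Type :=
  {I : Finset (Fin q) // I.Nonempty ∧ Even I.card}

/-- The ordered monomial `η^I = η^{i₁} ⋯ η^{i_j}`, for `I = {i₁ < ⋯ < i_j}`. -/
def monomial {q : ℕ} (I : Finset (Fin q)) : ExteriorAlgebra ℝ (Fin q → ℝ) :=
  ((I.sort (· ≤ ·)).map (eta q)).prod

theorem list_prod_mem_evenOdd {q : ℕ} (l : List (Fin q)) :
    (l.map (eta q)).prod ∈
      CliffordAlgebra.evenOdd (0 : QuadraticForm ℝ (Fin q → ℝ)) (l.length : ZMod 2) := by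
  induction l with
  | nil =>
    simpa using CliffordAlgebra.one_le_evenOdd_zero
      (0 : QuadraticForm ℝ (Fin q → ℝ)) (Submodule.one_le.mp le_rfl)
  | cons a l ih =>
    have h := SetLike.mul_mem_graded
      (CliffordAlgebra.ι_mem_evenOdd_one (0 : QuadraticForm ℝ (Fin q → ℝ)) (Pi.single a 1)) ih
    rw [List.map_cons, List.prod_cons, List.length_cons, Nat.cast_succ, add_comm]
    exact h

theorem monomial_mem_even {q : ℕ} (I : Finset (Fin q)) (hI : Even I.card) :
    monomial I ∈ CliffordAlgebra.even (0 : QuadraticForm ℝ (Fin q → ℝ)) := by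
  have h := list_prod_mem_evenOdd (I.sort (· ≤ ·))
  rw [Finset.length_sort, (ZMod.natCast_eq_zero_iff_even).2 hI] at h
  exact h

/-- The monomial `η^I` as an even element. -/
def evenMonomial {q : ℕ} (I : EvenIndex q) : EvenGrassmann q :=
  ⟨monomial I.1, monomial_mem_even I.1 I.2.2⟩

/-! ### Functions -/

variable {m n : ℕ} {Ω : Opens (EuclideanSpace ℝ (Fin m))}
  {N : Type*} [TopologicalSpace N] [ChartedSpace (EuclideanSpace ℝ (Fin n)) N]

/-- The algebra `C^∞(|Ω| × ℝ^{0|q})⁰ = C^∞(|Ω|) ⊗ ℝ[η¹, …, η^q]⁰` of even superfunctions. -/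
abbrev EvenSuperFun (Ω : Opens (EuclideanSpace ℝ (Fin m))) (q : ℕ) : Type :=
  C^∞⟮𝓡 m, Ω; ℝ⟯ ⊗[ℝ] EvenGrassmann q

/-- The algebra `C^∞(U)`, for an open subset `U` of `|Ω| × N`. -/
abbrev SmoothFun (U : Opens (Ω × N)) : Type _ :=
  C^∞⟮(𝓡 m).prod (𝓡 n), U; ℝ⟯

/-- The pull-back `C^∞(N) → C^∞(U)` by the projection `(x, p) ↦ p`. -/
def projPullback (U : Opens (Ω × N)) : C^∞⟮𝓡 n, N; ℝ⟯ →ₐ[ℝ] SmoothFun (n := n) U where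
  toFun f := ⟨fun u => f u.1.2, f.contMDiff.comp (contMDiff_snd.comp contMDiff_subtype_val)⟩
  map_one' := rfl
  map_mul' _ _ := rfl
  map_zero' := rfl
  map_add' _ _ := rfl
  commutes' _ := rfl

open Classical in
/-- For `x ∈ |Ω|`, the function `p ↦ g (x, p)` on the open slice `{p | (x, p) ∈ U}`
(and `0` elsewhere). -/
def slice {U : Opens (Ω × N)} (g : U → ℝ) (x : Ω) : N → ℝ :=
  fun p => if h : (x, p) ∈ U then g ⟨(x, p), h⟩ else 0

theorem slice_contMDiffAt {U : Opens (Ω × N)} (g : SmoothFun (n := n) U) (u : U) :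
    ContMDiffAt ((𝓡 m).prod (𝓡 n)) 𝓘(ℝ, ℝ) ∞
      (fun z : Ω × N => SuperMap.slice g z.1 z.2) u.1 := by
  rw [← contMDiffAt_subtype_iff]
  refine (g.contMDiff u).congr_of_eventuallyEq (Filter.Eventually.of_forall fun v => ?_)
  have hv : (v.1.1, v.1.2) ∈ U := v.2
  simp [SuperMap.slice, hv]

theorem slice_contMDiffAt_right {U : Opens (Ω × N)} (g : SmoothFun (n := n) U) (u : U) :
    ContMDiffAt (𝓡 n) 𝓘(ℝ, ℝ) ∞ (SuperMap.slice g u.1.1) u.1.2 :=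
  ContMDiffAt.comp (f := fun p : N => (u.1.1, p)) u.1.2 (slice_contMDiffAt g u)
    (contMDiffAt_const.prodMk contMDiffAt_id)

theorem slice_add {U : Opens (Ω × N)} (g h : U → ℝ) (x : Ω) :
    SuperMap.slice (g + h) x = SuperMap.slice g x + SuperMap.slice h x := by
  funext p
  by_cases hp : (x, p) ∈ U <;> simp [SuperMap.slice, hp]

theorem slice_smul {U : Opens (Ω × N)} (c : ℝ) (g : U → ℝ) (x : Ω) :
    SuperMap.slice (c • g) x = c • SuperMap.slice g x := by
  funext p
  by_cases hp : (x, p) ∈ U <;> simp [SuperMap.slice, hp]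

/-- For `U` containing the graph of `φ`, the pull-back `(1 × φ)^* : C^∞(U) → C^∞(|Ω|)` by
`x ↦ (x, φ x)`. -/
def graphPullback (φ : C^∞⟮𝓡 m, Ω; 𝓡 n, N⟯) (U : Opens (Ω × N))
    (hU : ∀ x : Ω, (x, φ x) ∈ U) : SmoothFun (n := n) U →ₐ[ℝ] C^∞⟮𝓡 m, Ω; ℝ⟯ where
  toFun g := ⟨fun x => g ⟨(x, φ x), hU x⟩, fun x => by
    refine (ContMDiffAt.comp (f := fun x : Ω => (x, φ x)) x
      (slice_contMDiffAt g ⟨(x, φ x), hU x⟩)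
      ((contMDiff_id.prodMk φ.contMDiff) x)).congr_of_eventuallyEq
      (Filter.Eventually.of_forall fun z => ?_)
    simp [slice, hU z]⟩
  map_one' := rfl
  map_mul' _ _ := rfl
  map_zero' := rfl
  map_add' _ _ := rfl
  commutes' _ := rfl

/-! ### Vector fields tangent to `N`, depending smoothly on a point of `|Ω|` -/

section
variable [IsManifold (𝓡 n) ∞ N]

/-- A smooth section over `U ⊆ |Ω| × N` of the bundle `π^*TN`, whose fibre over `(x, p)` is the
tangent space `T_p N`. -/
structure VertField (U : Opens (Ω × N)) where
  /-- the value at a point `(x, p)` of `U` -/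
  val : ∀ u : U, TangentSpace (𝓡 n) u.1.2
  smooth : ContMDiff ((𝓡 m).prod (𝓡 n)) (𝓡 n).tangent ∞
    (fun u : U => (⟨u.1.2, val u⟩ : TangentBundle (𝓡 n) N))

open Classical in
/-- For `x ∈ |Ω|`, the vector field `p ↦ ξ (x, p)` on the open slice `{p | (x, p) ∈ U}`
(and `0` elsewhere). -/
def VertField.slice {U : Opens (Ω × N)} (ξ : VertField (n := n) U) (x : Ω) :
    ∀ p : N, TangentSpace (𝓡 n) p :=
  fun p => if h : (x, p) ∈ U then ξ.val ⟨(x, p), h⟩ else 0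

/-- The action `(ξ g)(x, p) = (ξ_x g(x, ·))(p)` of a field on a function on `U`. -/
def VertField.apply {U : Opens (Ω × N)} (ξ : VertField (n := n) U) (g : U → ℝ) (u : U) : ℝ :=
  mfderiv (𝓡 n) 𝓘(ℝ, ℝ) (SuperMap.slice g u.1.1) u.1.2 (ξ.val u)

/-- `[ξ, ζ] = 0`: the Lie bracket of the vector fields `ξ_x` and `ζ_x` vanishes on the slice of
`U`, for every `x ∈ |Ω|`. -/
def VertField.Commutes {U : Opens (Ω × N)} (ξ ζ : VertField (n := n) U) : Prop :=
  ∀ u : U, VectorField.mlieBracket (𝓡 n) (ξ.slice u.1.1) (ζ.slice u.1.1) u.1.2 = 0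

theorem VertField.apply_contMDiff {U : Opens (Ω × N)} (ξ : VertField (n := n) U)
    (g : SmoothFun (n := n) U) :
    ContMDiff ((𝓡 m).prod (𝓡 n)) 𝓘(ℝ, ℝ) ∞ (ξ.apply g) := by
  intro u₀
  have : IsManifold (𝓡 n) 1 N := IsManifold.of_le (n := ∞) (by simp)
  let b₂ : U → ℝ := fun u => SuperMap.slice g u.1.1 u.1.2
  have hsnd : ContMDiffAt ((𝓡 m).prod (𝓡 n)) (𝓡 n) ∞ (fun u : U => u.1.2) u₀ :=
    (contMDiff_snd.comp contMDiff_subtype_val) u₀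
  have hφ := ContMDiffAt.mfderiv (I := 𝓡 n) (I' := 𝓘(ℝ, ℝ)) (m := ∞) (n := ∞)
    (fun (u : U) (p : N) => SuperMap.slice g u.1.1 p) (fun u : U => u.1.2) (x₀ := u₀)
    (ContMDiffAt.comp (f := fun w : U × N => (w.1.1.1, w.2)) (u₀, u₀.1.2)
      (slice_contMDiffAt g u₀)
      (((contMDiff_fst.comp contMDiff_subtype_val).comp contMDiff_fst).prodMk
        contMDiff_snd _))
    hsnd (by simp)
  have hb₂ : ContMDiffAt ((𝓡 m).prod (𝓡 n)) 𝓘(ℝ, ℝ) ∞ b₂ u₀ :=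
    contMDiffAt_subtype_iff.mpr (slice_contMDiffAt g u₀)
  have h := ContMDiffAt.clm_apply_of_inCoordinates
    (b₁ := fun u : U => u.1.2) (b₂ := b₂) (v := fun u : U => ξ.val u) hφ (ξ.smooth u₀) hb₂
  exact (contMDiff_snd_tangentBundle_modelSpace ℝ 𝓘(ℝ, ℝ)).contMDiffAt.comp u₀ h

/-- The first order differential operator on `C^∞(U)` given by a field. -/
def VertField.lie {U : Opens (Ω × N)} (ξ : VertField (n := n) U) :
    SmoothFun (n := n) U →ₗ[ℝ] SmoothFun (n := n) U where
  toFun g := ⟨ξ.apply g, ξ.apply_contMDiff g⟩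
  map_add' g h := by
    ext u
    change mfderiv (𝓡 n) 𝓘(ℝ, ℝ) (SuperMap.slice (⇑g + ⇑h) u.1.1) u.1.2 (ξ.val u) = _
    rw [slice_add, mfderiv_add ((slice_contMDiffAt_right g u).mdifferentiableAt (by simp))
      ((slice_contMDiffAt_right h u).mdifferentiableAt (by simp))]
    rfl
  map_smul' c g := by
    ext u
    change mfderiv (𝓡 n) 𝓘(ℝ, ℝ) (SuperMap.slice (c • ⇑g) u.1.1) u.1.2 (ξ.val u) = _
    rw [slice_smul, const_smul_mfderiv
      ((slice_contMDiffAt_right g u).mdifferentiableAt (by simp))]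
    rfl

/-- `Ξ = ∑_I ξ_I η^I`, acting on `C^∞(U) ⊗ ℝ[η¹, …, η^q]⁰` by `g η^J ↦ ∑_I (ξ_I g) η^I η^J`. -/
def evenField {q : ℕ} {U : Opens (Ω × N)} (ξ : EvenIndex q → VertField (n := n) U) :
    Module.End ℝ (SmoothFun (n := n) U ⊗[ℝ] EvenGrassmann q) :=
  ∑ I : EvenIndex q,
    TensorProduct.map (ξ I).lie (LinearMap.mulLeft ℝ (evenMonomial I))

/-- `e^Ξ = ∑_{k ≤ [q/2]} Ξ^k / k!`; the higher powers of `Ξ` vanish. -/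
def expField {q : ℕ} {U : Opens (Ω × N)} (ξ : EvenIndex q → VertField (n := n) U) :
    Module.End ℝ (SmoothFun (n := n) U ⊗[ℝ] EvenGrassmann q) :=
  ∑ k ∈ Finset.range (q / 2 + 1), ((k.factorial : ℝ)⁻¹) • (evenField ξ) ^ k

/-- The superfunction `(1 × φ)^*(e^Ξ f)`, for `f ∈ C^∞(N)`. -/
def pullbackExp {q : ℕ} (φ : C^∞⟮𝓡 m, Ω; 𝓡 n, N⟯) (U : Opens (Ω × N))
    (hU : ∀ x : Ω, (x, φ x) ∈ U) (ξ : EvenIndex q → VertField (n := n) U)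
    (f : C^∞⟮𝓡 n, N; ℝ⟯) : EvenSuperFun Ω q :=
  TensorProduct.map (graphPullback φ U hU).toLinearMap LinearMap.id
    (expField ξ (projPullback U f ⊗ₜ[ℝ] 1))

end

end SuperMap

end

open scoped Manifold ContDiff TensorProduct
open TopologicalSpace

noncomputable section

namespace SuperMap

/-! ### Structure of the even Grassmann algebra -/

section Grassmann

variable {q : ℕ}

/-! The even Grassmann algebra is commutative, so `Ξ` is a derivation; each `η^I` has degree at
least 2, so `Ξ` is nilpotent. The exponential of a nilpotent derivation is multiplicative
(`expField_mul`), which gives the first half. For the converse, the body of `Φ` at `x` is a real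
character of `C^∞(N)`, hence evaluation at a point `φ x` (`exists_eq_eval_of_algHom`), and `φ` is
smooth because every `f ∘ φ` is. The key fact is rigidity (`algHom_eq_of_augmentation`): two
morphisms into the even Grassmann algebra over the same point `p` coincide once they agree on
functions whose differentials span the cotangent space at `p`. By Hadamard's lemma other functions
matter only modulo the square of the ideal of `p`, where a difference of the two morphisms gains
Grassmann degree. It remains to match `Φ` on coordinates depending smoothly on `x`, although the
image of `φ` need not lie in one chart. Take functions `F a` and locally finite vector fields `W a`
with `∑ dF a ⊗ W a = id` (`exists_coframe`). Then `H_x(p) = ∑ F a(p) W a(φ x)`, with values in the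
tangent space at `φ x`, has derivative the identity at `p = φ x`. If `Φ(F a)` has coefficients `b a
I`, let `ξ_I` be the field that `dH_x` sends to the constant vector `∑ b a I(x) W a(φ x)`. Fields
constant in common coordinates commute, and on the components of `H_x` the exponential stops after
its linear term, where it equals `Φ` by construction. For a chart `y`, the fields just found extend
`Φ` to functions on `U`. The coefficients of the images of the `y^i` then define new fields,
constant in `y`, and rigidity shows that they induce the same morphism. -/

theorem eta_mul_eta_swap (i j : Fin q) : eta q i * eta q j = -(eta q j * eta q i) :=
  eq_neg_of_add_eq_zero_left (ExteriorAlgebra.ι_add_mul_swap _ _)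

theorem list_prod_eq_or_neg_of_perm {l l' : List (Fin q)} (h : l.Perm l') :
    (l.map (eta q)).prod = (l'.map (eta q)).prod ∨
      (l.map (eta q)).prod = -(l'.map (eta q)).prod := by
  induction h with
  | nil => exact Or.inl rfl
  | cons a _ ih => rcases ih with ih | ih <;> simp [ih]
  | swap a b l =>
    right
    simp only [List.map_cons, List.prod_cons, ← mul_assoc]
    rw [eta_mul_eta_swap, neg_mul]
  | trans _ _ ih₁ ih₂ =>
    rcases ih₁ with ih₁ | ih₁ <;> rcases ih₂ with ih₂ | ih₂ <;> simp [ih₁, ih₂]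

/-- Up to sign, two equal generators can be moved to the front, where their product is zero. -/
theorem list_prod_eq_zero_of_not_nodup {l : List (Fin q)} (h : ¬ l.Nodup) :
    (l.map (eta q)).prod = 0 := by
  obtain ⟨a, ha⟩ : ∃ a, List.Duplicate a l := by
    simpa [List.nodup_iff_forall_not_duplicate] using h
  obtain ⟨l', hl'⟩ := (List.duplicate_iff_sublist.1 ha).exists_perm_append
  rcases list_prod_eq_or_neg_of_perm hl' with h | h <;>
    simp [h, ← mul_assoc, eta]

/-- The elements of the Grassmann algebra of degree at least `d`. -/
def degreeGE (q d : ℕ) : Submodule ℝ (ExteriorAlgebra ℝ (Fin q → ℝ)) :=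
  Submodule.span ℝ {x | ∃ l : List (Fin q), d ≤ l.length ∧ x = (l.map (eta q)).prod}

theorem mul_mem_degreeGE {d e : ℕ} {x y : ExteriorAlgebra ℝ (Fin q → ℝ)}
    (hx : x ∈ degreeGE q d) (hy : y ∈ degreeGE q e) : x * y ∈ degreeGE q (d + e) := by
  have h := Submodule.mul_mem_mul hx hy
  rw [degreeGE, degreeGE, Submodule.span_mul_span] at h
  refine Submodule.span_mono ?_ h
  rintro _ ⟨_, ⟨l, hl, rfl⟩, _, ⟨l', hl', rfl⟩, rfl⟩
  exact ⟨l ++ l', by simp; omega, by simp⟩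

/-- A word of more than `q` letters repeats one of them. All nilpotency arguments below rest on
this. -/
theorem degreeGE_eq_bot {d : ℕ} (hd : q < d) : degreeGE q d = ⊥ := by
  rw [degreeGE, Submodule.span_eq_bot]
  rintro _ ⟨l, hl, rfl⟩
  refine list_prod_eq_zero_of_not_nodup fun h => ?_
  have := h.length_le_card
  simp at this
  omega

theorem monomial_mem_degreeGE (I : Finset (Fin q)) {d : ℕ} (hd : d ≤ I.card) :
    monomial I ∈ degreeGE q d :=
  Submodule.subset_span ⟨I.sort (· ≤ ·), by simpa using hd, rfl⟩

theorem evenMonomial_mem_degreeGE (I : EvenIndex q) :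
    (evenMonomial I : ExteriorAlgebra ℝ (Fin q → ℝ)) ∈ degreeGE q 2 := by
  refine monomial_mem_degreeGE _ ?_
  obtain ⟨k, hk⟩ := I.2.2
  have := I.2.1.card_pos
  omega

theorem ι_eq_sum_eta (v : Fin q → ℝ) :
    CliffordAlgebra.ι (0 : QuadraticForm ℝ (Fin q → ℝ)) v = ∑ i, v i • eta q i := by
  conv_lhs => rw [← Finset.univ_sum_single v]
  rw [map_sum]
  refine Finset.sum_congr rfl fun i _ => ?_
  have : (Pi.single i (v i) : Fin q → ℝ) = v i • Pi.single i 1 := by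
    rw [← Pi.single_smul, smul_eq_mul, mul_one]
  rw [this, map_smul]
  rfl

theorem even_le_span_list (x : EvenGrassmann q) :
    (x : ExteriorAlgebra ℝ (Fin q → ℝ)) ∈ Submodule.span ℝ
      {x | ∃ l : List (Fin q), Even l.length ∧ x = (l.map (eta q)).prod} := by
  obtain ⟨x, hx⟩ := x
  change x ∈ _
  induction x, hx using CliffordAlgebra.even_induction with
  | algebraMap r =>
    rw [Algebra.algebraMap_eq_smul_one]
    exact Submodule.smul_mem _ _ (Submodule.subset_span ⟨[], by simp, rfl⟩)
  | add x y hx hy ihx ihy => exact Submodule.add_mem _ ihx ihy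
  | ι_mul_ι_mul v w x hx ih =>
    rw [ι_eq_sum_eta, ι_eq_sum_eta, Finset.sum_mul_sum, Finset.sum_mul]
    refine Submodule.sum_mem _ fun i _ => ?_
    rw [Finset.sum_mul]
    refine Submodule.sum_mem _ fun j _ => ?_
    rw [smul_mul_smul_comm, smul_mul_assoc]
    refine Submodule.smul_mem _ _ ?_
    clear hx
    induction ih using Submodule.span_induction with
    | mem x h =>
      obtain ⟨l, hl, rfl⟩ := h
      exact Submodule.subset_span ⟨i :: j :: l, by simpa [parity_simps] using hl,
        by simp [mul_assoc]⟩
    | zero => simp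
    | add x y _ _ hx hy => rw [mul_add]; exact Submodule.add_mem _ hx hy
    | smul c x _ hx => rw [mul_smul_comm]; exact Submodule.smul_mem _ _ hx

/-- Only spanning is needed: the linear independence of the monomials is never used. -/
theorem span_evenMonomial (x : EvenGrassmann q) :
    ∃ (c : ℝ) (b : EvenIndex q → ℝ), x = c • 1 + ∑ I, b I • evenMonomial I := by
  suffices h : (x : ExteriorAlgebra ℝ (Fin q → ℝ)) ∈ Submodule.span ℝ {1} ⊔
      Submodule.span ℝ (Set.range fun I : EvenIndex q => monomial I.1) by
    obtain ⟨y, hy, z, hz, hyz⟩ := Submodule.mem_sup.1 h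
    obtain ⟨c, rfl⟩ := Submodule.mem_span_singleton.1 hy
    obtain ⟨b, rfl⟩ := (Submodule.mem_span_range_iff_exists_fun ℝ).1 hz
    refine ⟨c, b, Subtype.ext ?_⟩
    rw [← hyz]
    simp [evenMonomial]
  refine Submodule.span_le.2 ?_ (even_le_span_list x)
  rintro _ ⟨l, hl, rfl⟩
  by_cases hn : l.Nodup
  · have hp : l.Perm (l.toFinset.sort (· ≤ ·)) :=
      (List.perm_ext_iff_of_nodup hn (Finset.sort_nodup _ _)).2 fun a => by simp
    have key : monomial l.toFinset ∈ Submodule.span ℝ {1} ⊔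
        Submodule.span ℝ (Set.range fun I : EvenIndex q => monomial I.1) := by
      rcases l.toFinset.eq_empty_or_nonempty with he | he
      · rw [he]
        exact Submodule.mem_sup_left (Submodule.subset_span (by simp [monomial]))
      · refine Submodule.mem_sup_right (Submodule.subset_span ⟨⟨l.toFinset, he, ?_⟩, rfl⟩)
        rwa [List.toFinset_card_of_nodup hn]
    rcases list_prod_eq_or_neg_of_perm hp with h | h
    · rw [SetLike.mem_coe, h]; exact key
    · rw [SetLike.mem_coe, h]; exact Submodule.neg_mem _ key
  · rw [SetLike.mem_coe, list_prod_eq_zero_of_not_nodup hn]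
    exact Submodule.zero_mem _

theorem evenGrassmann_mul_comm (x y : EvenGrassmann q) : x * y = y * x := by
  have key : ∀ (v w u : Fin q → ℝ),
      ExteriorAlgebra.ι ℝ v * ExteriorAlgebra.ι ℝ w * ExteriorAlgebra.ι ℝ u =
        ExteriorAlgebra.ι ℝ u * (ExteriorAlgebra.ι ℝ v * ExteriorAlgebra.ι ℝ w) := by
    intro v w u
    have h₁ := eq_neg_of_add_eq_zero_left (ExteriorAlgebra.ι_add_mul_swap (R := ℝ) w u)
    have h₂ := eq_neg_of_add_eq_zero_left (ExteriorAlgebra.ι_add_mul_swap (R := ℝ) v u)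
    rw [mul_assoc, h₁, mul_neg, ← mul_assoc, h₂, neg_mul, neg_neg, mul_assoc]
  have hl : ∀ z : ExteriorAlgebra ℝ (Fin q → ℝ), ∀ u : Fin q → ℝ,
      z ∈ CliffordAlgebra.evenOdd (0 : QuadraticForm ℝ (Fin q → ℝ)) 0 →
      z * ExteriorAlgebra.ι ℝ u = ExteriorAlgebra.ι ℝ u * z := by
    intro z u hz
    induction z, hz using CliffordAlgebra.even_induction with
    | algebraMap r => exact Algebra.commutes r _
    | add x y hx hy ihx ihy => rw [add_mul, mul_add, ihx, ihy]
    | ι_mul_ι_mul v w x hx ih =>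
      rw [mul_assoc, ih, ← mul_assoc, ← mul_assoc]
      exact congrArg (· * x) (key v w u)
  obtain ⟨x, hx⟩ := x
  obtain ⟨y, hy⟩ := y
  refine Subtype.ext ?_
  change x * y = y * x
  -- Evenness of `x` alone suffices: it makes `x` central in the whole exterior algebra, so the
  -- induction may run over arbitrary `y`.
  clear hy
  induction y using ExteriorAlgebra.induction with
  | algebraMap r => exact (Algebra.commutes r x).symm
  | ι u => exact hl x u hx
  | mul a b ha hb => rw [← mul_assoc, ha, mul_assoc, hb, mul_assoc]
  | add a b ha hb => rw [mul_add, add_mul, ha, hb]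

/-- The projection of an even element on its component of degree zero. -/
def augmentation (q : ℕ) : EvenGrassmann q →ₐ[ℝ] ℝ :=
  (ExteriorAlgebra.algebraMapInv (R := ℝ) (M := Fin q → ℝ)).comp
    (CliffordAlgebra.even (0 : QuadraticForm ℝ (Fin q → ℝ))).val

theorem augmentation_evenMonomial (I : EvenIndex q) : augmentation q (evenMonomial I) = 0 := by
  change ExteriorAlgebra.algebraMapInv (monomial I.1) = 0
  rw [monomial, map_list_prod, List.prod_eq_zero_iff]
  obtain ⟨i, hi⟩ := I.2.1
  simp only [List.map_map, List.mem_map, Finset.mem_sort]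
  exact ⟨i, hi, by simp [eta, ExteriorAlgebra.algebraMapInv]⟩

theorem mem_degreeGE_two_of_augmentation_eq_zero {x : EvenGrassmann q}
    (hx : augmentation q x = 0) : (x : ExteriorAlgebra ℝ (Fin q → ℝ)) ∈ degreeGE q 2 := by
  obtain ⟨c, b, rfl⟩ := span_evenMonomial x
  have hc : c = 0 := by simpa [augmentation_evenMonomial] using hx
  rw [hc, zero_smul, zero_add, AddSubmonoidClass.coe_finsetSum]
  exact Submodule.sum_mem _ fun I _ => Submodule.smul_mem _ _ (evenMonomial_mem_degreeGE I)

theorem coe_pow_mem_degreeGE {x : EvenGrassmann q} (hx : augmentation q x = 0) (k : ℕ) :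
    ((x ^ k : EvenGrassmann q) : ExteriorAlgebra ℝ (Fin q → ℝ)) ∈ degreeGE q (2 * k) := by
  induction k with
  | zero => exact Submodule.subset_span ⟨[], by simp, by simp⟩
  | succ k ih =>
    rw [pow_succ, mul_add]
    exact mul_mem_degreeGE ih (mem_degreeGE_two_of_augmentation_eq_zero hx)

theorem pow_eq_zero_of_augmentation_eq_zero {x : EvenGrassmann q} (hx : augmentation q x = 0) :
    x ^ (q / 2 + 1) = 0 := by
  have h := coe_pow_mem_degreeGE hx (q / 2 + 1)
  rw [degreeGE_eq_bot (by omega), Submodule.mem_bot] at h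
  exact Subtype.ext h

end Grassmann

/-! ### Pointwise values and bodies of even superfunctions -/

section Evaluation

variable {m : ℕ} {Ω : Opens (EuclideanSpace ℝ (Fin m))} {q : ℕ}

/-- The evaluation of smooth functions at a point. -/
def evalAlgHom {d : ℕ} {M : Type*} [TopologicalSpace M] [ChartedSpace (EuclideanSpace ℝ (Fin d)) M]
    (x : M) : C^∞⟮𝓡 d, M; ℝ⟯ →ₐ[ℝ] ℝ where
  toFun f := f x
  map_one' := rfl
  map_mul' _ _ := rfl
  map_zero' := rfl
  map_add' _ _ := rfl
  commutes' _ := rfl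

/-- The value of an even superfunction at a point of `Ω`. -/
def evalAt (q : ℕ) (x : Ω) : EvenSuperFun Ω q →ₐ[ℝ] EvenGrassmann q :=
  (Algebra.TensorProduct.lid ℝ (EvenGrassmann q)).toAlgHom.comp
    (Algebra.TensorProduct.map (evalAlgHom x) (AlgHom.id ℝ _))

@[simp]
theorem evalAt_tmul (x : Ω) (f : C^∞⟮𝓡 m, Ω; ℝ⟯) (a : EvenGrassmann q) :
    evalAt q x (f ⊗ₜ a) = f x • a := rfl

/-- Evaluation at `x` reads off the values at `x` of the coefficients in a basis of the Grassmann
factor. Identities of superfunctions can thus be checked with `x` frozen, in a finite-dimensional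
algebra. -/
theorem superFun_ext {u v : EvenSuperFun Ω q} (h : ∀ x, evalAt q x u = evalAt q x v) : u = v := by
  let b := Module.Free.chooseBasis ℝ (EvenGrassmann q)
  let e := TensorProduct.equivFinsuppOfBasisRight (M := C^∞⟮𝓡 m, Ω; ℝ⟯) b
  have key : ∀ (w : EvenSuperFun Ω q) (x : Ω) i, b.repr (evalAt q x w) i = e w i x := by
    intro w x i
    induction w using TensorProduct.induction_on with
    | zero => simp
    | tmul f a => simp [e, mul_comm]
    | add w₁ w₂ h₁ h₂ => simp [h₁, h₂]
  apply e.injective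
  ext i x
  rw [← key, ← key, h]

/-- The body of an even superfunction. -/
def body (Ω : Opens (EuclideanSpace ℝ (Fin m))) (q : ℕ) :
    EvenSuperFun Ω q →ₐ[ℝ] C^∞⟮𝓡 m, Ω; ℝ⟯ :=
  (Algebra.TensorProduct.rid ℝ ℝ (C^∞⟮𝓡 m, Ω; ℝ⟯)).toAlgHom.comp
    (Algebra.TensorProduct.map (AlgHom.id ℝ _) (augmentation q))

@[simp]
theorem body_tmul (f : C^∞⟮𝓡 m, Ω; ℝ⟯) (a : EvenGrassmann q) :
    body Ω q (f ⊗ₜ a) = augmentation q a • f := rfl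

theorem body_apply (u : EvenSuperFun Ω q) (x : Ω) :
    body Ω q u x = augmentation q (evalAt q x u) := by
  induction u using TensorProduct.induction_on with
  | zero => simp
  | tmul f a => simp [mul_comm]
  | add u v hu hv => simp [hu, hv]

theorem exists_coefficients (u : EvenSuperFun Ω q) :
    ∃ b : EvenIndex q → C^∞⟮𝓡 m, Ω; ℝ⟯,
      u = body Ω q u ⊗ₜ 1 + ∑ I, b I ⊗ₜ evenMonomial I := by
  induction u using TensorProduct.induction_on with
  | zero => exact ⟨0, by simp⟩
  | tmul f a =>
    obtain ⟨c, b, rfl⟩ := span_evenMonomial a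
    refine ⟨fun I => b I • f, ?_⟩
    simp [augmentation_evenMonomial, TensorProduct.tmul_add, TensorProduct.tmul_sum,
      TensorProduct.smul_tmul]
  | add u v hu hv =>
    obtain ⟨b, hb⟩ := hu
    obtain ⟨c, hc⟩ := hv
    refine ⟨b + c, ?_⟩
    conv_lhs => rw [hb, hc]
    simp only [map_add, TensorProduct.add_tmul, Pi.add_apply, Finset.sum_add_distrib]
    abel

end Evaluation

/-! ### The exponential of an even vertical field -/

section Exponential

variable {m n q : ℕ} {Ω : Opens (EuclideanSpace ℝ (Fin m))}
  {N : Type*} [TopologicalSpace N] [ChartedSpace (EuclideanSpace ℝ (Fin n)) N]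

theorem slice_mul {U : Opens (Ω × N)} (g h : U → ℝ) (x : Ω) :
    SuperMap.slice (g * h) x = SuperMap.slice g x * SuperMap.slice h x := by
  funext p
  by_cases hp : (x, p) ∈ U <;> simp [SuperMap.slice, hp]

variable {U : Opens (Ω × N)}

/-- The superfunctions on `U` whose coefficients belong to `K`, of Grassmann degree at least
`d`. -/
def filtered (K : Submodule ℝ (SmoothFun (n := n) U)) (q d : ℕ) :
    Submodule ℝ (SmoothFun (n := n) U ⊗[ℝ] EvenGrassmann q) :=
  Submodule.span ℝ {x | ∃ g ∈ K, ∃ a : EvenGrassmann q,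
    (a : ExteriorAlgebra ℝ (Fin q → ℝ)) ∈ degreeGE q d ∧ x = g ⊗ₜ a}

theorem mem_filtered_zero (x : SmoothFun (n := n) U ⊗[ℝ] EvenGrassmann q) :
    x ∈ filtered (⊤ : Submodule ℝ (SmoothFun (n := n) U)) q 0 := by
  induction x using TensorProduct.induction_on with
  | zero => simp
  | add x y hx hy => exact Submodule.add_mem _ hx hy
  | tmul g a =>
    refine Submodule.subset_span ⟨g, trivial, a, ?_, rfl⟩
    refine Submodule.span_mono ?_ (even_le_span_list a)
    rintro _ ⟨l, -, rfl⟩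
    exact ⟨l, Nat.zero_le _, rfl⟩

/-- The functions on `U` vanishing on the slice over `x`. -/
def vanishingOnSlice (U : Opens (Ω × N)) (x : Ω) : Submodule ℝ (SmoothFun (n := n) U) where
  carrier := {g | ∀ u : U, u.1.1 = x → g u = 0}
  zero_mem' _ _ := rfl
  add_mem' hg hh u hu := (congrArg₂ (· + ·) (hg u hu) (hh u hu)).trans (add_zero 0)
  smul_mem' c _ hg u hu := (congrArg (c * ·) (hg u hu)).trans (mul_zero c)

theorem degreeGE_antitone (q : ℕ) : Antitone (degreeGE q) := by
  intro d e hde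
  refine Submodule.span_mono ?_
  rintro _ ⟨l, hl, rfl⟩
  exact ⟨l, hde.trans hl, rfl⟩

theorem filtered_le (K : Submodule ℝ (SmoothFun (n := n) U)) (q d : ℕ) :
    filtered K q d ≤ filtered K q 0 := by
  refine Submodule.span_mono ?_
  rintro _ ⟨g, hg, a, ha, rfl⟩
  exact ⟨g, hg, a, degreeGE_antitone q (Nat.zero_le d) ha, rfl⟩

/-- The evaluation of superfunctions on `U` at the point `(x, φ x)` of the graph of `φ`. -/
def evalAtGraph (q : ℕ) (φ : C^∞⟮𝓡 m, Ω; 𝓡 n, N⟯) (hU : ∀ x : Ω, (x, φ x) ∈ U) (x : Ω) :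
    SmoothFun (n := n) U ⊗[ℝ] EvenGrassmann q →ₐ[ℝ] EvenGrassmann q :=
  (evalAt q x).comp
    (Algebra.TensorProduct.map (graphPullback φ U hU) (AlgHom.id ℝ (EvenGrassmann q)))

theorem evalAtGraph_tmul (φ : C^∞⟮𝓡 m, Ω; 𝓡 n, N⟯) (hU : ∀ x : Ω, (x, φ x) ∈ U) (x : Ω)
    (g : SmoothFun (n := n) U) (a : EvenGrassmann q) :
    evalAtGraph q φ hU x (g ⊗ₜ a) = g ⟨(x, φ x), hU x⟩ • a := rfl

theorem evalAtGraph_eq_zero {φ : C^∞⟮𝓡 m, Ω; 𝓡 n, N⟯} (hU : ∀ x : Ω, (x, φ x) ∈ U) {x : Ω}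
    {z : SmoothFun (n := n) U ⊗[ℝ] EvenGrassmann q}
    (hz : z ∈ filtered (vanishingOnSlice U x) q 0) : evalAtGraph q φ hU x z = 0 := by
  induction hz using Submodule.span_induction with
  | mem z h =>
    obtain ⟨g, hg, a, ha, rfl⟩ := h
    rw [evalAtGraph_tmul, hg _ rfl, zero_smul]
  | zero => exact map_zero _
  | add x y _ _ hx hy => rw [map_add, hx, hy, add_zero]
  | smul c x _ hx => rw [map_smul, hx, smul_zero]

variable [IsManifold (𝓡 n) ∞ N]

theorem VertField.lie_mul (ξ : VertField (n := n) U) (g h : SmoothFun (n := n) U) :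
    ξ.lie (g * h) = g * ξ.lie h + ξ.lie g * h := by
  ext u
  have hg := ((slice_contMDiffAt_right g u).mdifferentiableAt (by simp)).hasMFDerivAt
  have hh := ((slice_contMDiffAt_right h u).mdifferentiableAt (by simp)).hasMFDerivAt
  have hgu : SuperMap.slice g u.1.1 u.1.2 = g u := by
    have hu : (u.1.1, u.1.2) ∈ U := u.2
    simp [SuperMap.slice, hu]
  have hhu : SuperMap.slice h u.1.1 u.1.2 = h u := by
    have hu : (u.1.1, u.1.2) ∈ U := u.2
    simp [SuperMap.slice, hu]
  let D : (N → ℝ) → ℝ := fun s => mfderiv (𝓡 n) 𝓘(ℝ, ℝ) s u.1.2 (ξ.val u)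
  change D (SuperMap.slice (⇑g * ⇑h) u.1.1) =
    g u * D (SuperMap.slice h u.1.1) + D (SuperMap.slice g u.1.1) * h u
  rw [slice_mul, ← hgu, ← hhu, mul_comm (D (SuperMap.slice g u.1.1))]
  exact congrArg (fun L => L (ξ.val u)) (hg.mul hh).mfderiv

variable (ξ : EvenIndex q → VertField (n := n) U)

theorem evenField_tmul (g : SmoothFun (n := n) U) (a : EvenGrassmann q) :
    evenField ξ (g ⊗ₜ a) = ∑ I, (ξ I).lie g ⊗ₜ[ℝ] (evenMonomial I * a) := by
  simp [evenField]

theorem evenField_mul (x y : SmoothFun (n := n) U ⊗[ℝ] EvenGrassmann q) :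
    evenField ξ (x * y) = x * evenField ξ y + evenField ξ x * y := by
  induction x using TensorProduct.induction_on with
  | zero => simp
  | add x₁ x₂ h₁ h₂ => simp only [add_mul, map_add, h₁, h₂]; abel
  | tmul g a =>
    induction y using TensorProduct.induction_on with
    | zero => simp
    | add y₁ y₂ h₁ h₂ => simp only [mul_add, map_add, h₁, h₂]; abel
    | tmul h b =>
      simp only [Algebra.TensorProduct.tmul_mul_tmul, evenField_tmul, Finset.mul_sum,
        Finset.sum_mul, ← Finset.sum_add_distrib]
      refine Finset.sum_congr rfl fun I _ => ?_
      rw [VertField.lie_mul, TensorProduct.add_tmul, ← mul_assoc, ← mul_assoc,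
        evenGrassmann_mul_comm (evenMonomial I) a]

theorem evenField_one : evenField ξ 1 = 0 := by
  have h := evenField_mul ξ 1 1
  simp only [one_mul, mul_one] at h
  exact left_eq_add.mp h

theorem evenField_pow_succ_one (k : ℕ) : (evenField ξ ^ (k + 1)) 1 = 0 := by
  rw [pow_succ, Module.End.mul_apply, evenField_one, map_zero]

/-- Used with two choices of `K`: all functions, for the nilpotency of `Ξ`, and the functions
vanishing over `x`, for truncating the exponential at `x`. -/
theorem evenField_mem_filtered {K : Submodule ℝ (SmoothFun (n := n) U)}
    (hK : ∀ I, ∀ g ∈ K, (ξ I).lie g ∈ K) {d : ℕ}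
    {x : SmoothFun (n := n) U ⊗[ℝ] EvenGrassmann q} (hx : x ∈ filtered K q d) :
    evenField ξ x ∈ filtered K q (2 + d) := by
  induction hx using Submodule.span_induction with
  | mem x h =>
    obtain ⟨g, hg, a, ha, rfl⟩ := h
    rw [evenField_tmul]
    exact Submodule.sum_mem _ fun I _ => Submodule.subset_span
      ⟨_, hK I g hg, _, mul_mem_degreeGE (evenMonomial_mem_degreeGE I) ha, rfl⟩
  | zero => simp
  | add x y _ _ hx hy => rw [map_add]; exact Submodule.add_mem _ hx hy
  | smul c x _ hx => rw [map_smul]; exact Submodule.smul_mem _ _ hx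

theorem evenField_pow_mem_filtered {K : Submodule ℝ (SmoothFun (n := n) U)}
    (hK : ∀ I, ∀ g ∈ K, (ξ I).lie g ∈ K) {d : ℕ}
    {x : SmoothFun (n := n) U ⊗[ℝ] EvenGrassmann q} (hx : x ∈ filtered K q d) (k : ℕ) :
    (evenField ξ ^ k) x ∈ filtered K q (2 * k + d) := by
  induction k with
  | zero => simpa using hx
  | succ k ih =>
    rw [pow_succ', Module.End.mul_apply, show 2 * (k + 1) + d = 2 + (2 * k + d) by ring]
    exact evenField_mem_filtered ξ hK ih

theorem evenField_pow_eq_zero : evenField ξ ^ (q / 2 + 1) = 0 := by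
  refine TensorProduct.ext' fun g a => ?_
  have h := evenField_pow_mem_filtered ξ (K := ⊤) (fun _ _ _ => trivial)
    (mem_filtered_zero (g ⊗ₜ[ℝ] a)) (q / 2 + 1)
  have hbot : filtered (⊤ : Submodule ℝ (SmoothFun (n := n) U)) q (2 * (q / 2 + 1) + 0) = ⊥ := by
    rw [filtered, degreeGE_eq_bot (by omega), Submodule.span_eq_bot]
    rintro _ ⟨g, -, a, ha, rfl⟩
    rw [Submodule.mem_bot, ZeroMemClass.coe_eq_zero] at ha
    rw [ha, TensorProduct.tmul_zero]
  rw [hbot, Submodule.mem_bot] at h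
  exact h

theorem expField_mul (x y : SmoothFun (n := n) U ⊗[ℝ] EvenGrassmann q) :
    expField ξ (x * y) = expField ξ x * expField ξ y := by
  -- `IsNilpotent.exp` uses rational scalars; restricting the real structure makes its factors
  -- `1/k!` agree with those of `expField`.
  let _ : Module ℚ (SmoothFun (n := n) U ⊗[ℝ] EvenGrassmann q) :=
    Module.compHom _ (algebraMap ℚ ℝ)
  have h : expField ξ = IsNilpotent.exp (evenField ξ) := by
    rw [IsNilpotent.exp_eq_sum (evenField_pow_eq_zero ξ), expField]
    refine Finset.sum_congr rfl fun k _ => LinearMap.ext fun z => ?_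
    rw [LinearMap.smul_apply, LinearMap.smul_apply]
    change _ = (algebraMap ℚ ℝ ((k.factorial : ℚ)⁻¹)) • (evenField ξ ^ k) z
    simp
  rw [h]
  exact Module.End.exp_mul_of_derivation ℝ (SmoothFun (n := n) U ⊗[ℝ] EvenGrassmann q) (evenField ξ) (evenField_mul ξ)
    ⟨_, evenField_pow_eq_zero ξ⟩ x y

theorem expField_one : expField ξ 1 = 1 := by
  rw [expField, Finset.sum_range_succ']
  simp [evenField_pow_succ_one]

/-- The morphism `g ↦ (1 × φ)^*(e^Ξ g)` from `C^∞(U)` to the even superfunctions on `Ω`. -/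
def graphExp (φ : C^∞⟮𝓡 m, Ω; 𝓡 n, N⟯) (U : Opens (Ω × N)) (hU : ∀ x : Ω, (x, φ x) ∈ U)
    (ξ : EvenIndex q → VertField (n := n) U) : SmoothFun (n := n) U →ₐ[ℝ] EvenSuperFun Ω q :=
  (Algebra.TensorProduct.map (graphPullback φ U hU) (AlgHom.id ℝ (EvenGrassmann q))).comp
    ((AlgHom.ofLinearMap (expField ξ) (expField_one ξ) (expField_mul ξ)).comp
      Algebra.TensorProduct.includeLeft)

theorem graphExp_projPullback (φ : C^∞⟮𝓡 m, Ω; 𝓡 n, N⟯) (hU : ∀ x : Ω, (x, φ x) ∈ U)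
    (f : C^∞⟮𝓡 n, N; ℝ⟯) :
    graphExp φ U hU ξ (projPullback U f) = pullbackExp φ U hU ξ f := rfl

variable {ξ}

/-- The field is vertical: it differentiates only along the slice, on which `g` is identically zero.
-/
theorem VertField.lie_mem_vanishingOnSlice (ξ : VertField (n := n) U) {x : Ω}
    {g : SmoothFun (n := n) U} (hg : g ∈ vanishingOnSlice U x) :
    ξ.lie g ∈ vanishingOnSlice U x := by
  rintro u rfl
  have h : SuperMap.slice g u.1.1 = fun _ => 0 := by
    funext p
    by_cases hp : (u.1.1, p) ∈ U
    · simpa [SuperMap.slice, hp] using hg ⟨_, hp⟩ rfl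
    · simp [SuperMap.slice, hp]
  change mfderiv (𝓡 n) 𝓘(ℝ, ℝ) (SuperMap.slice g u.1.1) u.1.2 (ξ.val u) = 0
  rw [h, mfderiv_const]
  rfl

theorem evalAt_graphExp (φ : C^∞⟮𝓡 m, Ω; 𝓡 n, N⟯) (hU : ∀ x : Ω, (x, φ x) ∈ U)
    (x : Ω) (g : SmoothFun (n := n) U) :
    evalAt q x (graphExp φ U hU ξ g) = evalAtGraph q φ hU x (expField ξ (g ⊗ₜ 1)) := rfl

theorem evenField_sq_mem_filtered {x : Ω} {g : SmoothFun (n := n) U}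
    (hg : ∀ I J, (ξ I).lie ((ξ J).lie g) ∈ vanishingOnSlice U x) :
    (evenField ξ ^ 2) (g ⊗ₜ 1) ∈ filtered (vanishingOnSlice U x) q 0 := by
  rw [pow_two, Module.End.mul_apply, evenField_tmul, map_sum]
  refine Submodule.sum_mem _ fun J _ => ?_
  rw [evenField_tmul]
  refine Submodule.sum_mem _ fun I _ => ?_
  refine filtered_le _ q 2 (Submodule.subset_span ⟨_, hg I J, _, ?_, rfl⟩)
  rw [mul_one]
  exact degreeGE_antitone q (by norm_num)
    (mul_mem_degreeGE (evenMonomial_mem_degreeGE I) (evenMonomial_mem_degreeGE J))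

/-- The square of `Ξ` sends `g` to something vanishing over `x`, and further applications of `Ξ`
preserve this; only the terms `k = 0, 1` survive at `x`. -/
theorem evalAt_graphExp_of_lie_lie (φ : C^∞⟮𝓡 m, Ω; 𝓡 n, N⟯) (hU : ∀ x : Ω, (x, φ x) ∈ U)
    (x : Ω) (g : SmoothFun (n := n) U)
    (hg : ∀ I J, (ξ I).lie ((ξ J).lie g) ∈ vanishingOnSlice U x) :
    evalAt q x (graphExp φ U hU ξ g) = g ⟨(x, φ x), hU x⟩ • 1 +
      ∑ I, ((ξ I).lie g) ⟨(x, φ x), hU x⟩ • evenMonomial I := by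
  have h₃ : ∀ k, evalAtGraph q φ hU x ((evenField ξ ^ (k + 2)) (g ⊗ₜ 1)) = 0 := by
    intro k
    rw [pow_add, Module.End.mul_apply]
    exact evalAtGraph_eq_zero hU (filtered_le _ _ _ (evenField_pow_mem_filtered ξ
      (fun I g hg => (ξ I).lie_mem_vanishingOnSlice hg) (evenField_sq_mem_filtered hg) k))
  -- A vanishing term is added so that two leading terms can be split off even when `q / 2 = 0`.
  have hsum : expField ξ = ∑ k ∈ Finset.range (q / 2 + 2),
      ((k.factorial : ℝ)⁻¹) • (evenField ξ) ^ k := by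
    rw [Finset.sum_range_succ, evenField_pow_eq_zero, smul_zero, add_zero]
    rfl
  rw [evalAt_graphExp, hsum, Finset.sum_range_succ', Finset.sum_range_succ', LinearMap.add_apply,
    LinearMap.add_apply, LinearMap.sum_apply, map_add, map_add, map_sum, Finset.sum_eq_zero,
    zero_add, add_comm]
  · rw [LinearMap.smul_apply, LinearMap.smul_apply, pow_zero, zero_add, pow_one,
      Module.End.one_apply, evenField_tmul, map_smul, map_smul, evalAtGraph_tmul, map_sum]
    simp [evalAtGraph_tmul]
  · intro k _
    rw [LinearMap.smul_apply, map_smul]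
    exact (congrArg _ (h₃ k)).trans (smul_zero _)

/-- Every positive power of `Ξ` carries a factor `η^I`, which the augmentation kills. -/
theorem augmentation_evalAt_graphExp (φ : C^∞⟮𝓡 m, Ω; 𝓡 n, N⟯) (hU : ∀ x : Ω, (x, φ x) ∈ U)
    (x : Ω) (g : SmoothFun (n := n) U) :
    augmentation q (evalAt q x (graphExp φ U hU ξ g)) = g ⟨(x, φ x), hU x⟩ := by
  have h₁ : ∀ z, augmentation q (evalAtGraph q φ hU x (evenField ξ z)) = 0 := by
    intro z
    induction z using TensorProduct.induction_on with
    | zero => simp only [map_zero]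
    | tmul g a =>
      rw [evenField_tmul, map_sum, map_sum]
      refine Finset.sum_eq_zero fun I _ => ?_
      rw [evalAtGraph_tmul, map_smul, map_mul, augmentation_evenMonomial, zero_mul, smul_zero]
    | add z w hz hw => rw [map_add, map_add, map_add, hz, hw, add_zero]
  rw [evalAt_graphExp, expField, Finset.sum_range_succ', LinearMap.add_apply,
    LinearMap.sum_apply, map_add, map_add, map_sum, map_sum, Finset.sum_eq_zero, zero_add]
  · rw [LinearMap.smul_apply, pow_zero, Module.End.one_apply, map_smul, evalAtGraph_tmul]
    simp
  · intro k _
    rw [LinearMap.smul_apply, pow_succ', Module.End.mul_apply, map_smul, map_smul, h₁, smul_zero]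

end Exponential

/-! ### Functions vanishing to second order at a point -/

section Hadamard

open scoped Topology

/-- Differentiation under the integral sign, by induction on the order; the target `G` varies in the
induction because the derivative takes values in `E →L[ℝ] G`. The dominating constant comes from
compactness of a closed ball times `[0, 1]`. -/
theorem contDiff_intervalIntegral_of_contDiff_uncurry {E : Type} [NormedAddCommGroup E]
    [NormedSpace ℝ E] [ProperSpace E] (k : ℕ) :
    ∀ {G : Type} [NormedAddCommGroup G] [NormedSpace ℝ G] [CompleteSpace G] {F : E × ℝ → G},
      ContDiff ℝ ∞ F → ContDiff ℝ k (fun y => ∫ t in (0 : ℝ)..1, F (y, t)) := by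
  induction k with
  | zero =>
    intro G _ _ _ F hF
    simp only [Nat.cast_zero, contDiff_zero]
    exact intervalIntegral.continuous_parametric_intervalIntegral_of_continuous'
      (f := fun y t => F (y, t)) hF.continuous 0 1
  | succ k ih =>
    intro G _ _ _ F hF
    let F' : E × ℝ → E →L[ℝ] G := fun z => (fderiv ℝ F z).comp (ContinuousLinearMap.inl ℝ E ℝ)
    have hF' : ContDiff ℝ ∞ F' := (hF.fderiv_right (by simp)).clm_comp contDiff_const
    have hder : ∀ y t, HasFDerivAt (fun y => F (y, t)) (F' (y, t)) y := by
      intro y t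
      exact ((hF.differentiable (by simp)) (y, t)).hasFDerivAt.comp y
        (hasFDerivAt_prodMk_left y t)
    push_cast
    refine contDiff_succ_iff_hasFDerivAt.2 ⟨fun y => ∫ t in (0 : ℝ)..1, F' (y, t), ih hF',
      fun y₀ => ?_⟩
    obtain ⟨C, hC⟩ := ((isCompact_closedBall y₀ 1).prod
      (isCompact_Icc (a := (0 : ℝ)) (b := 1))).exists_bound_of_continuousOn
      hF'.continuous.continuousOn
    have hcont : ∀ y, Continuous fun t => F (y, t) := fun y =>
      hF.continuous.comp (Continuous.prodMk_right y)
    refine intervalIntegral.hasFDerivAt_integral_of_dominated_of_fderiv_le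
      (F' := fun y t => F' (y, t)) (bound := fun _ => C)
      (Metric.closedBall_mem_nhds y₀ one_pos)
      (Filter.Eventually.of_forall fun y => (hcont y).aestronglyMeasurable)
      ((hcont y₀).intervalIntegrable _ _)
      (hF'.continuous.comp (Continuous.prodMk_right y₀)).aestronglyMeasurable
      (Filter.Eventually.of_forall fun t ht y hy => hC (y, t) ⟨hy, ?_⟩)
      (by simp) (Filter.Eventually.of_forall fun t _ y _ => hder y t)
    rw [Set.uIoc_of_le zero_le_one] at ht
    exact ⟨ht.1.le, ht.2⟩

/-- Hadamard's lemma. -/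
theorem exists_contDiff_eq_add_clm_apply {E : Type} [NormedAddCommGroup E]
    [NormedSpace ℝ E] [ProperSpace E] {f : E → ℝ} (hf : ContDiff ℝ ∞ f) (y₀ : E) :
    ∃ g : E → E →L[ℝ] ℝ, ContDiff ℝ ∞ g ∧ g y₀ = fderiv ℝ f y₀ ∧
      ∀ y, f y = f y₀ + g y (y - y₀) := by
  -- The derivative of `f` along the segment from `y₀` to `y`; its average over `t` is the required
  -- `g`.
  let F : E × ℝ → E →L[ℝ] ℝ := fun z => fderiv ℝ f (y₀ + z.2 • (z.1 - y₀))
  have hF : ContDiff ℝ ∞ F := (hf.fderiv_right (m := ∞) (by simp)).comp (by fun_prop)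
  refine ⟨fun y => ∫ t in (0 : ℝ)..1, F (y, t),
    contDiff_infty.2 fun k => contDiff_intervalIntegral_of_contDiff_uncurry k hF, by simp [F],
    fun y => ?_⟩
  have hc : Continuous fun t => F (y, t) := hF.continuous.comp (Continuous.prodMk_right y)
  have h := intervalIntegral.integral_eq_sub_of_hasDerivAt (a := 0) (b := 1)
    (f := fun t : ℝ => f (y₀ + t • (y - y₀))) (f' := fun t => F (y, t) (y - y₀))
    (fun t _ => by
      have h₁ : HasDerivAt (fun t : ℝ => y₀ + t • (y - y₀)) (y - y₀) t := by
        simpa using ((hasDerivAt_id t).smul_const (y - y₀)).const_add y₀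
      exact ((hf.differentiable (by simp)) _).hasFDerivAt.comp_hasDerivAt t h₁)
    ((hc.clm_apply continuous_const).intervalIntegrable _ _)
  change f y = f y₀ + (∫ t in (0 : ℝ)..1, F (y, t)) (y - y₀)
  rw [ContinuousLinearMap.intervalIntegral_apply (hc.intervalIntegrable _ _), h]
  simp

variable {n : ℕ} {N : Type*} [TopologicalSpace N] [ChartedSpace (EuclideanSpace ℝ (Fin n)) N]

/-- The square of the ideal of functions vanishing at `p`. -/
def idealSq (n : ℕ) {N : Type*} [TopologicalSpace N]
    [ChartedSpace (EuclideanSpace ℝ (Fin n)) N] (p : N) : Submodule ℝ C^∞⟮𝓡 n, N; ℝ⟯ :=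
  Submodule.span ℝ {f | ∃ g h : C^∞⟮𝓡 n, N; ℝ⟯, g p = 0 ∧ h p = 0 ∧ f = g * h}

theorem clm_apply_eq_sum (L : EuclideanSpace ℝ (Fin n) →L[ℝ] ℝ) (v : EuclideanSpace ℝ (Fin n)) :
    L v = ∑ i, v i * L (EuclideanSpace.single i 1) := by
  conv_lhs => rw [← (EuclideanSpace.basisFun (Fin n) ℝ).sum_repr v]
  simp

variable [IsManifold (𝓡 n) ∞ N]

/-- The cut-off makes `f`, read in a chart, a smooth function on the whole model space, as the
segments in Hadamard's lemma require. -/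
theorem contDiff_bump_mul_comp_symm {p : N} (ρ : SmoothBumpFunction (𝓡 n) p)
    (f : C^∞⟮𝓡 n, N; ℝ⟯) :
    ContDiff ℝ ∞ fun y => ρ.toContDiffBump y * f ((extChartAt (𝓡 n) p).symm y) := by
  rw [contDiff_iff_contDiffAt]
  intro y
  by_cases hy : y ∈ Metric.closedBall (extChartAt (𝓡 n) p p) ρ.rOut
  · have ht : y ∈ (extChartAt (𝓡 n) p).target := ρ.closedBall_subset ⟨hy, by simp⟩
    refine ρ.toContDiffBump.contDiffAt.mul ?_
    rw [← contMDiffAt_iff_contDiffAt]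
    refine (f.contMDiff _).comp y ((contMDiffOn_extChartAt_symm p).contMDiffAt ?_)
    exact (isOpen_extChartAt_target p).mem_nhds ht
  · refine (contDiffAt_const (c := (0 : ℝ))).congr_of_eventuallyEq ?_
    filter_upwards [Metric.isClosed_closedBall.isOpen_compl.mem_nhds hy] with z hz
    rw [ρ.toContDiffBump.zero_of_le_dist (le_of_not_ge hz), zero_mul]

variable [T2Space N]

theorem mem_idealSq_of_mfderiv_eq_zero {p : N} {f : C^∞⟮𝓡 n, N; ℝ⟯} (h₀ : f p = 0)
    (h₁ : mfderiv (𝓡 n) 𝓘(ℝ, ℝ) f p = 0) : f ∈ idealSq n p := by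
  obtain ⟨ρ⟩ : Nonempty (SmoothBumpFunction (𝓡 n) p) := inferInstance
  let χ := extChartAt (𝓡 n) p
  obtain ⟨g, hg, hg₀, hfg⟩ := exists_contDiff_eq_add_clm_apply
    (contDiff_bump_mul_comp_symm ρ f) (χ p)
  have hgp : g (χ p) = 0 := by
    rw [hg₀]
    have hd := ((f.contMDiff p).mdifferentiableAt (by simp)).hasMFDerivAt
    rw [h₁] at hd
    have hd' : HasFDerivAt (fun y => f (χ.symm y))
        (0 : EuclideanSpace ℝ (Fin n) →L[ℝ] ℝ) (χ p) := by
      have h₂ : HasFDerivWithinAt (fun y => f (χ.symm y))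
          (0 : EuclideanSpace ℝ (Fin n) →L[ℝ] ℝ) (Set.range (𝓡 n)) (χ p) := hd.2
      rwa [ModelWithCorners.range_eq_univ, hasFDerivWithinAt_univ] at h₂
    refine (hd'.congr_of_eventuallyEq ?_).fderiv
    filter_upwards [ρ.toContDiffBump.eventuallyEq_one] with y hy
    rw [hy, Pi.one_apply, one_mul]
  have hχ : ContMDiffOn (𝓡 n) 𝓘(ℝ, EuclideanSpace ℝ (Fin n)) ∞ χ
      (chartAt (EuclideanSpace ℝ (Fin n)) p).source := contMDiffOn_extChartAt
  have hρp : ρ p = 1 := ρ.eq_one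
  let ρ' : C^∞⟮𝓡 n, N; ℝ⟯ := ⟨ρ, ρ.contMDiff⟩
  let a : Fin n → C^∞⟮𝓡 n, N; ℝ⟯ := fun i => ⟨fun z => ρ z • (χ z - χ p) i,
    ρ.contMDiff_smul ((EuclideanSpace.proj i : EuclideanSpace ℝ (Fin n) →L[ℝ] ℝ).contDiff
      |>.contMDiff.comp_contMDiffOn (hχ.sub contMDiffOn_const))⟩
  let b : Fin n → C^∞⟮𝓡 n, N; ℝ⟯ := fun i => ⟨fun z => ρ z • g (χ z) (EuclideanSpace.single i 1),
    ρ.contMDiff_smul ((hg.clm_apply contDiff_const).contMDiff.comp_contMDiffOn hχ)⟩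
  -- The exponent 3 counts one `ρ` in `a i`, one in `b i` and one in the cut-off function to which
  -- Hadamard's lemma was applied. Each product, including `(1 - ρ' ^ 3) * f`, has both factors zero
  -- at `p`.
  have key : f = (1 - ρ' ^ 3) * f + ∑ i, a i * b i := by
    ext z
    have hs : (∑ i, a i * b i : C^∞⟮𝓡 n, N; ℝ⟯) z = ∑ i, a i z * b i z := by
      rw [← ContMDiffMap.coeFnAddMonoidHom_apply, map_sum, Finset.sum_apply]
      rfl
    change f z = (1 - ρ z ^ 3) * f z + (∑ i, a i * b i : C^∞⟮𝓡 n, N; ℝ⟯) z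
    rw [hs]
    change _ = _ + ∑ i, (ρ z * (χ z - χ p) i) * (ρ z * g (χ z) (EuclideanSpace.single i 1))
    by_cases hz : z ∈ (chartAt (EuclideanSpace ℝ (Fin n)) p).source
    · have h := hfg (χ z)
      have hρz : ρ.toContDiffBump (χ z) = ρ z := (ρ.eqOn_source hz).symm
      rw [χ.left_inv (by simpa [χ] using hz), χ.left_inv (by simp [χ]), h₀, mul_zero, zero_add,
        hρz, clm_apply_eq_sum] at h
      have : ∑ i, (ρ z * (χ z - χ p) i) * (ρ z * g (χ z) (EuclideanSpace.single i 1)) =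
          ρ z ^ 2 * (ρ z * f z) := by
        rw [h, Finset.mul_sum]
        exact Finset.sum_congr rfl fun i _ => by ring
      rw [this]
      ring
    · have : ρ z = 0 := by
        by_contra h
        exact hz (ρ.support_subset_source h)
      simp [this]
  rw [key]
  refine Submodule.add_mem _ (Submodule.subset_span ⟨_, _, ?_, h₀, rfl⟩)
    (Submodule.sum_mem _ fun i _ => Submodule.subset_span ⟨_, _, ?_, ?_, rfl⟩)
  · change 1 - ρ p ^ 3 = 0
    rw [hρp]
    norm_num
  · change ρ p * (χ p - χ p) i = 0
    simp
  · change ρ p * g (χ p) _ = 0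
    simp [hgp]

end Hadamard

/-! ### Morphisms from the algebra of smooth functions -/

section Rigidity

variable {n q : ℕ} {N : Type*} [TopologicalSpace N] [ChartedSpace (EuclideanSpace ℝ (Fin n)) N]

/-- The differential at `p`, as a linear map on smooth functions. -/
def differentialAt (p : N) :
    C^∞⟮𝓡 n, N; ℝ⟯ →ₗ[ℝ] (EuclideanSpace ℝ (Fin n) →L[ℝ] ℝ) where
  toFun f := mfderiv (𝓡 n) 𝓘(ℝ, ℝ) f p
  map_add' f g := mfderiv_add ((f.contMDiff p).mdifferentiableAt (by simp))
    ((g.contMDiff p).mdifferentiableAt (by simp))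
  map_smul' c f := const_smul_mfderiv ((f.contMDiff p).mdifferentiableAt (by simp)) c

theorem differentialAt_algebraMap (p : N) (c : ℝ) :
    differentialAt p (algebraMap ℝ C^∞⟮𝓡 n, N; ℝ⟯ c) = 0 :=
  mfderiv_const

/-- Modulo constants and the span of the `g i`, every `f` lies in the square of the ideal of `p`,
because injectivity on tangent vectors means that the differentials span. On a product `a * b` from
this square, the difference of the morphisms is a sum of products of such a difference with an
element of degree at least 2, so its degree can be raised until it vanishes. -/
theorem algHom_eq_of_augmentation {p : N} [IsManifold (𝓡 n) ∞ N] [T2Space N]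
    {χ₁ χ₂ : C^∞⟮𝓡 n, N; ℝ⟯ →ₐ[ℝ] EvenGrassmann q}
    (h₁ : ∀ f, augmentation q (χ₁ f) = f p) (h₂ : ∀ f, augmentation q (χ₂ f) = f p)
    (g : Fin n → C^∞⟮𝓡 n, N; ℝ⟯) (hg : ∀ i, χ₁ (g i) = χ₂ (g i))
    (hinj : ∀ v, (∀ i, differentialAt p (g i) v = 0) → v = 0) : χ₁ = χ₂ := by
  have hdec : ∀ f, ∃ r ∈ idealSq n p, χ₁ f - χ₂ f = χ₁ r - χ₂ r := by
    intro f
    have hspan : (differentialAt p f).toLinearMap ∈ Submodule.span ℝ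
        (Set.range fun i => (differentialAt p (g i)).toLinearMap) := by
      refine mem_span_of_iInf_ker_le_ker fun v hv => ?_
      have : v = 0 := hinj v fun i => by simpa using (Submodule.mem_iInf _).1 hv i
      rw [this]
      exact zero_mem _
    obtain ⟨c, hc⟩ := (Submodule.mem_span_range_iff_exists_fun ℝ).1 hspan
    have hd : differentialAt p f = ∑ i, c i • differentialAt p (g i) := by
      ext v
      have := LinearMap.congr_fun hc v
      simp only [LinearMap.sum_apply, LinearMap.smul_apply, ContinuousLinearMap.coe_coe] at this
      simp [← this]
    let s := ∑ i, c i • g i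
    refine ⟨f - s - algebraMap ℝ _ (f p - s p), mem_idealSq_of_mfderiv_eq_zero ?_ ?_, ?_⟩
    · change f p - s p - (f p - s p) = 0
      ring
    · change differentialAt p (f - s - algebraMap ℝ _ (f p - s p)) = 0
      rw [map_sub, map_sub, differentialAt_algebraMap, hd, map_sum]
      simp
    · have hs : χ₁ s = χ₂ s := by simp [s, hg]
      simp only [map_sub χ₁, map_sub χ₂, AlgHom.commutes, hs]
      abel
  have hker : ∀ χ : C^∞⟮𝓡 n, N; ℝ⟯ →ₐ[ℝ] EvenGrassmann q,
      (∀ f, augmentation q (χ f) = f p) → ∀ f : C^∞⟮𝓡 n, N; ℝ⟯, f p = 0 →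
        (χ f : ExteriorAlgebra ℝ (Fin q → ℝ)) ∈ degreeGE q 2 :=
    fun χ hχ f hf => mem_degreeGE_two_of_augmentation_eq_zero ((hχ f).trans hf)
  have key : ∀ (k : ℕ) (f : C^∞⟮𝓡 n, N; ℝ⟯),
      ((χ₁ f - χ₂ f : EvenGrassmann q) : ExteriorAlgebra ℝ (Fin q → ℝ)) ∈ degreeGE q (k + 2) := by
    intro k
    induction k with
    | zero =>
      intro f
      refine mem_degreeGE_two_of_augmentation_eq_zero ?_
      rw [map_sub, h₁, h₂, sub_self]
    | succ k ih =>
      intro f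
      obtain ⟨r, hr, hfr⟩ := hdec f
      rw [hfr]
      clear hfr
      induction hr using Submodule.span_induction with
      | mem r h =>
        obtain ⟨a, b, ha, hb, rfl⟩ := h
        have hab : χ₁ (a * b) - χ₂ (a * b) =
            χ₁ a * (χ₁ b - χ₂ b) + (χ₁ a - χ₂ a) * χ₂ b := by
          rw [map_mul, map_mul, mul_sub, sub_mul]
          abel
        rw [hab]
        refine Submodule.add_mem _ ?_ ?_
        · exact degreeGE_antitone q (by omega) (mul_mem_degreeGE (hker χ₁ h₁ a ha) (ih b))
        · exact degreeGE_antitone q (by omega) (mul_mem_degreeGE (ih a) (hker χ₂ h₂ b hb))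
      | zero => simp
      | add a b _ _ ha hb =>
        rw [map_add, map_add, add_sub_add_comm]
        exact Submodule.add_mem _ ha hb
      | smul c a _ ha =>
        rw [map_smul, map_smul, ← smul_sub]
        exact Submodule.smul_mem _ _ ha
  refine AlgHom.ext fun f => ?_
  -- Degree at least `q + 2` exceeds the top degree `q`.
  have h := key q f
  rw [degreeGE_eq_bot (by omega), Submodule.mem_bot, ZeroMemClass.coe_eq_zero] at h
  exact sub_eq_zero.1 h

/-- Iterating gives `g - g' = h ^ k * (g - g')` for all `k`, and `χ h` is nilpotent. With `h` one
minus a bump function, this says that `χ` depends only on germs. -/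
theorem apply_eq_of_forall_mul_eq {B : Type*} [Ring B] [Algebra ℝ B]
    (χ : B →ₐ[ℝ] EvenGrassmann q) {h g g' : B} (hh : augmentation q (χ h) = 0)
    (hg : g - g' = h * (g - g')) : χ g = χ g' := by
  have hk : ∀ k : ℕ, g - g' = h ^ k * (g - g') := by
    intro k
    induction k with
    | zero => simp
    | succ k ih => rw [pow_succ, mul_assoc, ← hg, ← ih]
  have := congrArg χ (hk (q / 2 + 1))
  rw [map_mul, map_pow, pow_eq_zero_of_augmentation_eq_zero hh, zero_mul, map_sub] at this
  exact sub_eq_zero.1 this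

end Rigidity

/-! ### Real characters are point evaluations; the underlying map -/

section Characters

open scoped Topology

variable {n : ℕ} {N : Type*} [TopologicalSpace N] [ChartedSpace (EuclideanSpace ℝ (Fin n)) N]
  [IsManifold (𝓡 n) ∞ N] [T2Space N]

theorem exists_contMDiffMap_isCompact_fibers [SigmaCompactSpace N] :
    ∃ h : C^∞⟮𝓡 n, N; ℝ⟯, ∀ c : ℝ, IsCompact {p | h p = c} := by
  have : LocallyCompactSpace N := Manifold.locallyCompact_of_finiteDimensional (𝓡 n)
  let K := CompactExhaustion.choice N
  -- A smooth function bounding from above the index at which a point enters a compact exhaustion;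
  -- each of its fibres then lies in one compact set of the exhaustion.
  obtain ⟨h, hh⟩ := exists_contMDiffMap_forall_mem_convex_of_local_const (I := 𝓡 n) (n := ⊤)
    (t := fun p : N => Set.Ici (K.find p : ℝ)) (fun p => convex_Ici _) fun p =>
      ⟨(K.find p + 1 : ℕ), by
        filter_upwards [mem_interior_iff_mem_nhds.1 (K.subset_interior_succ _ (K.mem_find p))]
          with z hz
        exact (Nat.cast_le (α := ℝ)).2 (K.mem_iff_find_le.1 hz)⟩
  refine ⟨h, fun c => ?_⟩
  refine (K.isCompact ⌈c⌉₊).of_isClosed_subset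
    (isClosed_eq h.contMDiff.continuous continuous_const) fun p hp => ?_
  rw [K.mem_iff_find_le]
  have h₁ : (K.find p : ℝ) ≤ h p := hh p
  rw [show h p = c from hp] at h₁
  exact_mod_cast h₁.trans (Nat.le_ceil c)

/-- If `χ` were no evaluation, its kernel would contain for each `p` a function nonzero at `p`.
Finitely many of these have no common zero on the compact fibre `h = χ h`, and `h - χ h` is nonzero
elsewhere. The sum of their squares is an invertible element of the kernel, which is absurd. -/
theorem exists_eq_eval_of_algHom [SigmaCompactSpace N] (χ : C^∞⟮𝓡 n, N; ℝ⟯ →ₐ[ℝ] ℝ) :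
    ∃ p : N, ∀ f, χ f = f p := by
  by_contra! hcon
  choose F hF using hcon
  let G : N → C^∞⟮𝓡 n, N; ℝ⟯ := fun p => F p - algebraMap ℝ _ (χ (F p))
  have hG : ∀ p, G p p ≠ 0 := fun p => sub_ne_zero.2 (hF p).symm
  have hχG : ∀ p, χ (G p) = 0 := fun p => by
    rw [map_sub, AlgHom.commutes]
    exact sub_self _
  obtain ⟨h, hh⟩ := exists_contMDiffMap_isCompact_fibers (n := n) (N := N)
  obtain ⟨t, ht⟩ := (hh (χ h)).elim_finite_subcover (fun p => {z | G p z ≠ 0})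
    (fun p => isOpen_ne_fun (G p).contMDiff.continuous continuous_const)
    (fun p _ => Set.mem_iUnion.2 ⟨p, hG p⟩)
  let H : C^∞⟮𝓡 n, N; ℝ⟯ := h - algebraMap ℝ _ (χ h)
  let u : C^∞⟮𝓡 n, N; ℝ⟯ := H ^ 2 + ∑ p ∈ t, G p ^ 2
  have hu : ∀ z, u z = (h z - χ h) ^ 2 + ∑ p ∈ t, G p z ^ 2 := by
    intro z
    have := map_add (evalAlgHom z) (H ^ 2) (∑ p ∈ t, G p ^ 2)
    rw [map_sum, map_pow] at this
    simp only [map_pow] at this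
    exact this
  have hpos : ∀ z, u z ≠ 0 := by
    intro z
    rw [hu]
    by_cases hz : h z = χ h
    · obtain ⟨p, hp, hpz⟩ := Set.mem_iUnion₂.1 (ht hz)
      have h₁ : 0 < ∑ p ∈ t, G p z ^ 2 :=
        Finset.sum_pos' (fun p _ => sq_nonneg _) ⟨p, hp, by have : G p z ≠ 0 := hpz; positivity⟩
      positivity
    · have h₁ : 0 < (h z - χ h) ^ 2 := by
        have := sub_ne_zero.2 hz
        positivity
      have h₂ : 0 ≤ ∑ p ∈ t, G p z ^ 2 := Finset.sum_nonneg fun p _ => sq_nonneg _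
      positivity
  let v : C^∞⟮𝓡 n, N; ℝ⟯ := ⟨fun z => (u z)⁻¹, u.contMDiff.inv₀ hpos⟩
  have huv : u * v = 1 := by
    ext z
    exact mul_inv_cancel₀ (hpos z)
  have hχu : χ u = 0 := by
    have hH : χ H = 0 := by
      rw [map_sub, AlgHom.commutes]
      exact sub_self _
    simp [u, hH, hχG]
  have := congrArg χ huv
  rw [map_mul, hχu, zero_mul, map_one] at this
  exact zero_ne_one this

/-- Test functions suffice: bump functions with small support give continuity, and cut-off
coordinates then give smoothness. -/
theorem contMDiff_of_forall_comp {m : ℕ} {M : Type*} [TopologicalSpace M]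
    [ChartedSpace (EuclideanSpace ℝ (Fin m)) M] {φ : M → N}
    (h : ∀ f : C^∞⟮𝓡 n, N; ℝ⟯, ContMDiff (𝓡 m) 𝓘(ℝ, ℝ) ∞ fun x => f (φ x)) :
    ContMDiff (𝓡 m) (𝓡 n) ∞ φ := by
  intro x
  have hcont : ContinuousAt φ x := by
    intro O hO
    obtain ⟨ρ, -, hρ⟩ := (SmoothBumpFunction.nhds_basis_support (I := 𝓡 n) hO).mem_iff.1 hO
    have hc := (h ⟨ρ, ρ.contMDiff⟩).continuous
    have : {z | ρ (φ z) ≠ 0} ∈ 𝓝 x := (isOpen_ne_fun hc continuous_const).mem_nhds (by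
      change ρ (φ x) ≠ 0
      rw [ρ.eq_one]
      exact one_ne_zero)
    exact Filter.mem_of_superset this fun z hz => hρ hz
  rw [contMDiffAt_iff_target]
  refine ⟨hcont, ?_⟩
  obtain ⟨ρ⟩ : Nonempty (SmoothBumpFunction (𝓡 n) (φ x)) := inferInstance
  have hχ : ContMDiffOn (𝓡 n) 𝓘(ℝ, EuclideanSpace ℝ (Fin n)) ∞ (extChartAt (𝓡 n) (φ x))
      (chartAt (EuclideanSpace ℝ (Fin n)) (φ x)).source := contMDiffOn_extChartAt
  let a : Fin n → C^∞⟮𝓡 n, N; ℝ⟯ := fun i => ⟨fun z => ρ z • (extChartAt (𝓡 n) (φ x) z) i,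
    ρ.contMDiff_smul ((EuclideanSpace.proj i : EuclideanSpace ℝ (Fin n) →L[ℝ] ℝ).contDiff
      |>.contMDiff.comp_contMDiffOn hχ)⟩
  have hsum : ContMDiff (𝓡 m) 𝓘(ℝ, EuclideanSpace ℝ (Fin n)) ∞ fun z =>
      ∑ i, a i (φ z) • EuclideanSpace.single i (1 : ℝ) :=
    contMDiff_finsetSum fun i _ => (h (a i)).smul contMDiff_const
  refine (hsum x).congr_of_eventuallyEq ?_
  filter_upwards [hcont.eventually ρ.eventuallyEq_one] with z hz
  conv_lhs => rw [Function.comp_apply,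
    ← (EuclideanSpace.basisFun (Fin n) ℝ).sum_repr (extChartAt (𝓡 n) (φ x) (φ z))]
  refine Finset.sum_congr rfl fun i _ => ?_
  change _ = (ρ (φ z) • (extChartAt (𝓡 n) (φ x) (φ z)) i) • _
  rw [hz]
  simp

theorem exists_underlying_map {m q : ℕ} {Ω : Opens (EuclideanSpace ℝ (Fin m))}
    [SigmaCompactSpace N] (Φ : C^∞⟮𝓡 n, N; ℝ⟯ →ₐ[ℝ] EvenSuperFun Ω q) :
    ∃ φ : C^∞⟮𝓡 m, Ω; 𝓡 n, N⟯, ∀ f x, body Ω q (Φ f) x = f (φ x) := by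
  choose φ hφ using fun x : Ω =>
    exists_eq_eval_of_algHom ((evalAlgHom x).comp ((body Ω q).comp Φ))
  refine ⟨⟨φ, contMDiff_of_forall_comp fun f => ?_⟩, fun f x => hφ x f⟩
  exact (body Ω q (Φ f)).contMDiff.congr fun x => (hφ x f).symm

end Characters

/-! ### Fields determined by a family of local diffeomorphisms -/

section Fields

open scoped Topology

variable {n : ℕ} {N : Type*} [TopologicalSpace N] [ChartedSpace (EuclideanSpace ℝ (Fin n)) N]
  [IsManifold (𝓡 n) ∞ N]
  {E' H' : Type*} [NormedAddCommGroup E'] [NormedSpace ℝ E'] [TopologicalSpace H']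
  {J : ModelWithCorners ℝ E' H'} {P : Type*} [TopologicalSpace P] [ChartedSpace H' P]
  [IsManifold J ∞ P]

theorem trivializationAt_snd_eq_mfderiv {p₀ p : N}
    (hp : p ∈ (chartAt (EuclideanSpace ℝ (Fin n)) p₀).source) (v : TangentSpace (𝓡 n) p) :
    (trivializationAt (EuclideanSpace ℝ (Fin n)) (TangentSpace (𝓡 n)) p₀ ⟨p, v⟩).2 =
      mfderiv (𝓡 n) 𝓘(ℝ, EuclideanSpace ℝ (Fin n)) (extChartAt (𝓡 n) p₀) p v := by
  have : IsManifold (𝓡 n) 1 N := IsManifold.of_le (n := ∞) (by simp)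
  have h := DFunLike.congr_fun (TangentBundle.continuousLinearMapAt_trivializationAt
    (𝕜 := ℝ) (I := 𝓡 n) hp) v
  refine Eq.trans ?_ h
  rw [Bundle.Trivialization.continuousLinearMapAt_apply,
    Bundle.Trivialization.linearMapAt_apply, if_pos]
  exact hp

/-- Factoring through the derivative of one fixed chart replaces maps out of varying tangent spaces
by a smooth family `A` of endomorphisms of the model space, on which invertibility and inversion can
be studied. -/
theorem exists_contMDiffAt_mfderiv_eq_comp {g : P → N} {H : P → N → EuclideanSpace ℝ (Fin n)}
    {u₀ : P} (hg : ContMDiffAt J (𝓡 n) ∞ g u₀)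
    (hH : ContMDiffAt (J.prod (𝓡 n)) 𝓘(ℝ, EuclideanSpace ℝ (Fin n)) ∞ (Function.uncurry H)
      (u₀, g u₀)) :
    ∃ A : P → EuclideanSpace ℝ (Fin n) →L[ℝ] EuclideanSpace ℝ (Fin n),
      ContMDiffAt J 𝓘(ℝ, EuclideanSpace ℝ (Fin n) →L[ℝ] EuclideanSpace ℝ (Fin n)) ∞ A u₀ ∧
      ∀ᶠ u in 𝓝 u₀, mfderiv (𝓡 n) 𝓘(ℝ, EuclideanSpace ℝ (Fin n)) (H u) (g u) =
        (A u).comp (mfderiv (𝓡 n) 𝓘(ℝ, EuclideanSpace ℝ (Fin n))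
          (extChartAt (𝓡 n) (g u₀)) (g u)) := by
  have : IsManifold (𝓡 n) 1 N := IsManifold.of_le (n := ∞) (by simp)
  refine ⟨_, ContMDiffAt.mfderiv (m := ∞) (n := ∞) H g hH hg (by simp), ?_⟩
  filter_upwards [hg.continuousAt.eventually
    ((chartAt (EuclideanSpace ℝ (Fin n)) (g u₀)).open_source.mem_nhds (mem_chart_source _ _))]
    with u hu
  rw [inTangentCoordinates_eq_mfderiv_comp hu (by exact Set.mem_univ _)]
  have h₁ := mfderivWithin_extChartAt_symm_comp_mfderiv_extChartAt' (I := 𝓡 n) (x := g u₀)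
    (y := g u) (by rw [extChartAt_source]; exact hu)
  have h₂ : mfderiv 𝓘(ℝ, EuclideanSpace ℝ (Fin n)) 𝓘(ℝ, EuclideanSpace ℝ (Fin n))
      (extChartAt 𝓘(ℝ, EuclideanSpace ℝ (Fin n)) (H u₀ (g u₀))) (H u (g u)) =
      ContinuousLinearMap.id ℝ _ := by
    rw [extChartAt_model_space_eq_id]
    exact mfderiv_id
  rw [h₂]
  ext1 v
  have h₃ := DFunLike.congr_fun h₁ v
  exact congrArg (mfderiv (𝓡 n) 𝓘(ℝ, EuclideanSpace ℝ (Fin n)) (H u) (g u)) h₃.symm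

theorem isInvertible_mfderiv_extChartAt_of_mem {p₀ p : N}
    (hp : p ∈ (chartAt (EuclideanSpace ℝ (Fin n)) p₀).source) :
    (mfderiv (𝓡 n) 𝓘(ℝ, EuclideanSpace ℝ (Fin n)) (extChartAt (𝓡 n) p₀) p).IsInvertible := by
  have : IsManifold (𝓡 n) 1 N := IsManifold.of_le (n := ∞) (by simp)
  exact isInvertible_mfderiv_extChartAt (by simpa using hp)

theorem isInvertible_comp_iff {E : Type*} [NormedAddCommGroup E] [NormedSpace ℝ E]
    {A B : E →L[ℝ] E} (hB : B.IsInvertible) : (A.comp B).IsInvertible ↔ A.IsInvertible := by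
  obtain ⟨e, rfl⟩ := hB
  exact ContinuousLinearMap.isInvertible_comp_equiv

theorem eventually_isInvertible_mfderiv {g : P → N} {H : P → N → EuclideanSpace ℝ (Fin n)}
    {u₀ : P} (hg : ContMDiffAt J (𝓡 n) ∞ g u₀)
    (hH : ContMDiffAt (J.prod (𝓡 n)) 𝓘(ℝ, EuclideanSpace ℝ (Fin n)) ∞ (Function.uncurry H)
      (u₀, g u₀))
    (hinv : (mfderiv (𝓡 n) 𝓘(ℝ, EuclideanSpace ℝ (Fin n)) (H u₀) (g u₀)).IsInvertible) :
    ∀ᶠ u in 𝓝 u₀, (mfderiv (𝓡 n) 𝓘(ℝ, EuclideanSpace ℝ (Fin n)) (H u) (g u)).IsInvertible := by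
  obtain ⟨A, hA, hHA⟩ := exists_contMDiffAt_mfderiv_eq_comp hg hH
  have hA₀ : (A u₀).IsInvertible := by
    rw [hHA.self_of_nhds] at hinv
    exact (isInvertible_comp_iff
      (isInvertible_mfderiv_extChartAt_of_mem (mem_chart_source _ _))).1 hinv
  obtain ⟨e, he⟩ := hA₀
  have hev : ∀ᶠ u in 𝓝 u₀, A u ∈ Set.range ((↑) : (EuclideanSpace ℝ (Fin n) ≃L[ℝ]
      EuclideanSpace ℝ (Fin n)) → _) := by
    refine hA.continuousAt.eventually ?_
    rw [← he]
    exact ContinuousLinearEquiv.nhds e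
  filter_upwards [hev, hHA, hg.continuousAt.eventually
    ((chartAt (EuclideanSpace ℝ (Fin n)) (g u₀)).open_source.mem_nhds (mem_chart_source _ _))]
    with u h₁ h₂ h₃
  rw [h₂]
  exact (isInvertible_comp_iff (isInvertible_mfderiv_extChartAt_of_mem h₃)).2 h₁

/-- In a fixed chart the vector is `A⁻¹ c`, and inversion is smooth near an invertible operator. -/
theorem contMDiffAt_tangent_of_mfderiv_eq {g : P → N} {H : P → N → EuclideanSpace ℝ (Fin n)}
    {u₀ : P} (hg : ContMDiffAt J (𝓡 n) ∞ g u₀)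
    (hH : ContMDiffAt (J.prod (𝓡 n)) 𝓘(ℝ, EuclideanSpace ℝ (Fin n)) ∞ (Function.uncurry H)
      (u₀, g u₀))
    (hinv : (mfderiv (𝓡 n) 𝓘(ℝ, EuclideanSpace ℝ (Fin n)) (H u₀) (g u₀)).IsInvertible)
    {c : P → EuclideanSpace ℝ (Fin n)}
    (hc : ContMDiffAt J 𝓘(ℝ, EuclideanSpace ℝ (Fin n)) ∞ c u₀)
    {ξ : ∀ u, TangentSpace (𝓡 n) (g u)}
    (hξ : ∀ᶠ u in 𝓝 u₀,
      mfderiv (𝓡 n) 𝓘(ℝ, EuclideanSpace ℝ (Fin n)) (H u) (g u) (ξ u) = c u) :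
    ContMDiffAt J (𝓡 n).tangent ∞ (fun u => (⟨g u, ξ u⟩ : TangentBundle (𝓡 n) N)) u₀ := by
  obtain ⟨A, hA, hHA⟩ := exists_contMDiffAt_mfderiv_eq_comp hg hH
  have hA₀ : (A u₀).IsInvertible := by
    rw [hHA.self_of_nhds] at hinv
    exact (isInvertible_comp_iff
      (isInvertible_mfderiv_extChartAt_of_mem (mem_chart_source _ _))).1 hinv
  obtain ⟨e, he⟩ := hA₀
  have hev : ∀ᶠ u in 𝓝 u₀, A u ∈ Set.range ((↑) : (EuclideanSpace ℝ (Fin n) ≃L[ℝ]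
      EuclideanSpace ℝ (Fin n)) → _) := by
    refine hA.continuousAt.eventually ?_
    rw [← he]
    exact ContinuousLinearEquiv.nhds e
  rw [Bundle.contMDiffAt_totalSpace]
  refine ⟨hg, ?_⟩
  have hAinv : ContMDiffAt J 𝓘(ℝ, EuclideanSpace ℝ (Fin n) →L[ℝ] EuclideanSpace ℝ (Fin n)) ∞
      (fun u => ContinuousLinearMap.inverse (A u)) u₀ := by
    refine ContMDiffAt.comp u₀ (g := ContinuousLinearMap.inverse) ?_ hA
    rw [← he]
    exact (contDiffAt_map_inverse e).contMDiffAt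
  refine (hAinv.clm_apply hc).congr_of_eventuallyEq ?_
  filter_upwards [hev, hHA, hξ, hg.continuousAt.eventually
    ((chartAt (EuclideanSpace ℝ (Fin n)) (g u₀)).open_source.mem_nhds (mem_chart_source _ _))]
    with u ⟨e', he'⟩ h₂ h₃ h₄
  refine (trivializationAt_snd_eq_mfderiv h₄ (ξ u)).trans ?_
  rw [h₂] at h₃
  rw [← h₃, ← he', ContinuousLinearMap.inverse_equiv]
  exact (e'.symm_apply_apply _).symm

/-- Near `p` both fields are pull-backs of constant fields under `H`, and the bracket commutes with
pull-back. -/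
theorem mlieBracket_eq_zero_of_mfderiv_eq {H : N → EuclideanSpace ℝ (Fin n)} {p : N}
    (hH : ContMDiffAt (𝓡 n) 𝓘(ℝ, EuclideanSpace ℝ (Fin n)) ∞ H p)
    {V W : ∀ z : N, TangentSpace (𝓡 n) z} {a b : EuclideanSpace ℝ (Fin n)}
    (hinv : ∀ᶠ z in 𝓝 p, (mfderiv (𝓡 n) 𝓘(ℝ, EuclideanSpace ℝ (Fin n)) H z).IsInvertible)
    (hV : ∀ᶠ z in 𝓝 p, mfderiv (𝓡 n) 𝓘(ℝ, EuclideanSpace ℝ (Fin n)) H z (V z) = a)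
    (hW : ∀ᶠ z in 𝓝 p, mfderiv (𝓡 n) 𝓘(ℝ, EuclideanSpace ℝ (Fin n)) H z (W z) = b) :
    VectorField.mlieBracket (𝓡 n) V W p = 0 := by
  have : IsManifold (𝓡 n) (minSmoothness ℝ 3) N := IsManifold.of_le (n := ∞) (by
    simpa using WithTop.coe_le_coe.2 (le_top : (3 : ℕ∞) ≤ ⊤))
  let C : EuclideanSpace ℝ (Fin n) → ∀ y : EuclideanSpace ℝ (Fin n),
      TangentSpace 𝓘(ℝ, EuclideanSpace ℝ (Fin n)) y := fun c _ => c
  have hpull : ∀ {V : ∀ z : N, TangentSpace (𝓡 n) z} {a : EuclideanSpace ℝ (Fin n)},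
      (∀ᶠ z in 𝓝 p, mfderiv (𝓡 n) 𝓘(ℝ, EuclideanSpace ℝ (Fin n)) H z (V z) = a) →
      V =ᶠ[𝓝 p] VectorField.mpullback (𝓡 n) 𝓘(ℝ, EuclideanSpace ℝ (Fin n)) H (C a) := by
    intro V a hV
    filter_upwards [hinv, hV] with z hz hVz
    rw [VectorField.mpullback_apply, ← show _ = C a (H z) from hVz]
    exact (ContinuousLinearMap.IsInvertible.inverse_apply_eq hz).2 rfl |>.symm
  have hC : ∀ (c y : EuclideanSpace ℝ (Fin n)), MDifferentiableAt 𝓘(ℝ, EuclideanSpace ℝ (Fin n))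
      𝓘(ℝ, EuclideanSpace ℝ (Fin n)).tangent
      (fun z => (⟨z, C c z⟩ : TangentBundle 𝓘(ℝ, EuclideanSpace ℝ (Fin n))
        (EuclideanSpace ℝ (Fin n)))) y := by
    intro c y
    refine ContMDiffAt.mdifferentiableAt (n := ∞) ?_ (by simp)
    exact (contMDiffAt_vectorSpace_iff_contDiffAt).2 contDiffAt_const
  rw [(hpull hV).mlieBracket_vectorField_eq (hpull hW),
    ← VectorField.mpullback_mlieBracket (n := ∞) (hC a _) (hC b _) hH
      (by simpa using WithTop.coe_le_coe.2 (le_top : (2 : ℕ∞) ≤ ⊤))]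
  have hz : VectorField.mlieBracket 𝓘(ℝ, EuclideanSpace ℝ (Fin n)) (C a) (C b) = 0 := by
    rw [← VectorField.mlieBracketWithin_univ, VectorField.mlieBracketWithin_eq_lieBracketWithin,
      VectorField.lieBracketWithin_univ]
    funext y
    simp [VectorField.lieBracket]
    rfl
  rw [hz, VectorField.mpullback_zero]
  rfl

end Fields

/-! ### Vertical fields that are constant in slicewise coordinates -/

section VertFields

open scoped Topology

variable {m n : ℕ} {Ω : Opens (EuclideanSpace ℝ (Fin m))}
  {N : Type*} [TopologicalSpace N] [ChartedSpace (EuclideanSpace ℝ (Fin n)) N]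

theorem mfderiv_clm_comp {F : Type*} [NormedAddCommGroup F] [NormedSpace ℝ F]
    {f : N → EuclideanSpace ℝ (Fin n)} {p : N} (L : EuclideanSpace ℝ (Fin n) →L[ℝ] F)
    (hf : ContMDiffAt (𝓡 n) 𝓘(ℝ, EuclideanSpace ℝ (Fin n)) ∞ f p) (v : TangentSpace (𝓡 n) p) :
    mfderiv (𝓡 n) 𝓘(ℝ, F) (fun z => L (f z)) p v =
      L (mfderiv (𝓡 n) 𝓘(ℝ, EuclideanSpace ℝ (Fin n)) f p v) := by
  have h := (L.hasMFDerivAt (x := f p)).comp p (hf.mdifferentiableAt (by simp)).hasMFDerivAt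
  exact DFunLike.congr_fun h.mfderiv v

variable [IsManifold (𝓡 n) ∞ N] {U : Opens (Ω × N)}

/-- Joint smoothness of `H` is not assumed: its values will be vectors tangent at `φ x`, and
identifying those tangent spaces with the model space need not be smooth in `x`. The local `τ`
corrects this, and the equation defining the field is unaffected by applying `τ x` to both sides. -/
theorem exists_vertFields_of_mfderiv {ι : Type*} {H : Ω → N → EuclideanSpace ℝ (Fin n)}
    {c : ι → Ω → EuclideanSpace ℝ (Fin n)}
    (hH : ∀ u ∈ U, ContMDiffAt (𝓡 n) 𝓘(ℝ, EuclideanSpace ℝ (Fin n)) ∞ (H u.1) u.2)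
    (hinv : ∀ u ∈ U,
      (mfderiv (𝓡 n) 𝓘(ℝ, EuclideanSpace ℝ (Fin n)) (H u.1) u.2).IsInvertible)
    (hloc : ∀ x₀ : Ω, ∃ τ : Ω → EuclideanSpace ℝ (Fin n) →L[ℝ] EuclideanSpace ℝ (Fin n),
      (τ x₀).IsInvertible ∧
      (∀ p, (x₀, p) ∈ U → ContMDiffAt ((𝓡 m).prod (𝓡 n)) 𝓘(ℝ, EuclideanSpace ℝ (Fin n)) ∞
        (fun z : Ω × N => τ z.1 (H z.1 z.2)) (x₀, p)) ∧
      ∀ I, ContMDiffAt (𝓡 m) 𝓘(ℝ, EuclideanSpace ℝ (Fin n)) ∞ (fun x => τ x (c I x)) x₀) :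
    ∃ ξ : ι → VertField (n := n) U, ∀ I (u : U),
      mfderiv (𝓡 n) 𝓘(ℝ, EuclideanSpace ℝ (Fin n)) (H u.1.1) u.1.2 ((ξ I).val u) =
        c I u.1.1 := by
  let ξ : ι → ∀ u : U, TangentSpace (𝓡 n) u.1.2 := fun I u => ContinuousLinearMap.inverse
    (mfderiv (𝓡 n) 𝓘(ℝ, EuclideanSpace ℝ (Fin n)) (H u.1.1) u.1.2) (c I u.1.1)
  have hξ : ∀ I u, mfderiv (𝓡 n) 𝓘(ℝ, EuclideanSpace ℝ (Fin n)) (H u.1.1) u.1.2 (ξ I u) =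
      c I u.1.1 := fun I u =>
    ((ContinuousLinearMap.IsInvertible.inverse_apply_eq (hinv u.1 u.2)).1 rfl).symm
  refine ⟨fun I => ⟨ξ I, fun u₀ => ?_⟩, hξ⟩
  obtain ⟨τ, hτ, hτH, hτc⟩ := hloc u₀.1.1
  have hfst : ContMDiffAt ((𝓡 m).prod (𝓡 n)) (𝓡 m) ∞ (fun u : U => u.1.1) u₀ :=
    (contMDiff_fst.comp contMDiff_subtype_val) u₀
  have hsnd : ContMDiffAt ((𝓡 m).prod (𝓡 n)) (𝓡 n) ∞ (fun u : U => u.1.2) u₀ :=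
    (contMDiff_snd.comp contMDiff_subtype_val) u₀
  have hder : ∀ u : U, ∀ v, mfderiv (𝓡 n) 𝓘(ℝ, EuclideanSpace ℝ (Fin n))
      (fun p => τ u.1.1 (H u.1.1 p)) u.1.2 v =
      τ u.1.1 (mfderiv (𝓡 n) 𝓘(ℝ, EuclideanSpace ℝ (Fin n)) (H u.1.1) u.1.2 v) :=
    fun u v => mfderiv_clm_comp (τ u.1.1) (hH u.1 u.2) v
  refine contMDiffAt_tangent_of_mfderiv_eq
    (H := fun (u : U) p => τ u.1.1 (H u.1.1 p)) (c := fun u => τ u.1.1 (c I u.1.1)) hsnd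
    (ContMDiffAt.comp (f := fun w : U × N => (w.1.1.1, w.2)) (u₀, u₀.1.2)
      (hτH u₀.1.2 u₀.2)
      (((contMDiff_fst.comp contMDiff_subtype_val).comp contMDiff_fst).prodMk
        contMDiff_snd _)) ?_
    (ContMDiffAt.comp (f := fun u : U => u.1.1) u₀ (hτc I) hfst)
    (Filter.Eventually.of_forall fun u => (hder u _).trans (congrArg _ (hξ I u)))
  have he : mfderiv (𝓡 n) 𝓘(ℝ, EuclideanSpace ℝ (Fin n))
      (fun p => τ u₀.1.1 (H u₀.1.1 p)) u₀.1.2 = (τ u₀.1.1).comp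
        (mfderiv (𝓡 n) 𝓘(ℝ, EuclideanSpace ℝ (Fin n)) (H u₀.1.1) u₀.1.2) :=
    ContinuousLinearMap.ext (hder u₀)
  rw [he]
  exact (isInvertible_comp_iff (hinv u₀.1 u₀.2)).2 hτ

theorem eventually_mem_slice (u : U) : ∀ᶠ p in 𝓝 u.1.2, (u.1.1, p) ∈ U := by
  have hc : Continuous fun p : N => (u.1.1, p) := by fun_prop
  exact hc.continuousAt.eventually (U.isOpen.mem_nhds u.2)

theorem VertField.commutes_of_mfderiv {ξ ζ : VertField (n := n) U}
    {H : Ω → N → EuclideanSpace ℝ (Fin n)} {a b : Ω → EuclideanSpace ℝ (Fin n)}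
    (hH : ∀ u ∈ U, ContMDiffAt (𝓡 n) 𝓘(ℝ, EuclideanSpace ℝ (Fin n)) ∞ (H u.1) u.2)
    (hinv : ∀ u ∈ U,
      (mfderiv (𝓡 n) 𝓘(ℝ, EuclideanSpace ℝ (Fin n)) (H u.1) u.2).IsInvertible)
    (hξ : ∀ u : U, mfderiv (𝓡 n) 𝓘(ℝ, EuclideanSpace ℝ (Fin n)) (H u.1.1) u.1.2 (ξ.val u) =
      a u.1.1)
    (hζ : ∀ u : U, mfderiv (𝓡 n) 𝓘(ℝ, EuclideanSpace ℝ (Fin n)) (H u.1.1) u.1.2 (ζ.val u) =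
      b u.1.1) : ξ.Commutes ζ := by
  intro u
  refine mlieBracket_eq_zero_of_mfderiv_eq (a := a u.1.1) (b := b u.1.1) (hH u.1 u.2) ?_ ?_ ?_
  · filter_upwards [eventually_mem_slice u] with p hp using hinv _ hp
  · filter_upwards [eventually_mem_slice u] with p hp
    rw [VertField.slice, dif_pos hp]
    exact hξ ⟨_, hp⟩
  · filter_upwards [eventually_mem_slice u] with p hp
    rw [VertField.slice, dif_pos hp]
    exact hζ ⟨_, hp⟩

theorem VertField.apply_eq_mfderiv (ξ : VertField (n := n) U) {g : U → ℝ} {f : N → ℝ} {x : Ω}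
    (hgf : ∀ u : U, u.1.1 = x → g u = f u.1.2) {u : U} (hu : u.1.1 = x) :
    ξ.apply g u = mfderiv (𝓡 n) 𝓘(ℝ, ℝ) f u.1.2 (ξ.val u) := by
  subst hu
  have h : SuperMap.slice g u.1.1 =ᶠ[𝓝 u.1.2] f := by
    filter_upwards [eventually_mem_slice u] with p hp
    rw [SuperMap.slice, dif_pos hp]
    exact hgf ⟨_, hp⟩ rfl
  rw [VertField.apply, h.mfderiv_eq]
  rfl

theorem VertField.apply_eq_of_mfderiv {ξ : VertField (n := n) U} {x : Ω} {g : U → ℝ}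
    {H : N → EuclideanSpace ℝ (Fin n)} {a : EuclideanSpace ℝ (Fin n)}
    {L : EuclideanSpace ℝ (Fin n) →L[ℝ] ℝ}
    (hH : ∀ u : U, u.1.1 = x → ContMDiffAt (𝓡 n) 𝓘(ℝ, EuclideanSpace ℝ (Fin n)) ∞ H u.1.2)
    (hξ : ∀ u : U, u.1.1 = x →
      mfderiv (𝓡 n) 𝓘(ℝ, EuclideanSpace ℝ (Fin n)) H u.1.2 (ξ.val u) = a)
    (hg : ∀ u : U, u.1.1 = x → g u = L (H u.1.2)) {u : U} (hu : u.1.1 = x) :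
    ξ.apply g u = L a := by
  rw [ξ.apply_eq_mfderiv (f := fun p => L (H p)) hg hu, ← hξ u hu]
  exact mfderiv_clm_comp L (hH u hu) (ξ.val u)

theorem VertField.apply_eq_zero_of_const (ξ : VertField (n := n) U) {x : Ω} {g : U → ℝ} {a : ℝ}
    (hg : ∀ u : U, u.1.1 = x → g u = a) {u : U} (hu : u.1.1 = x) : ξ.apply g u = 0 := by
  rw [ξ.apply_eq_mfderiv (f := fun _ => a) hg hu, mfderiv_const]
  rfl

/-- In the coordinates `H` the fields are constant and `g` is linear, so its second derivatives
along them vanish. -/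
theorem evalAt_graphExp_of_mfderiv {q : ℕ} {ξ : EvenIndex q → VertField (n := n) U}
    (φ : C^∞⟮𝓡 m, Ω; 𝓡 n, N⟯) (hU : ∀ x : Ω, (x, φ x) ∈ U) {x : Ω} {g : SmoothFun (n := n) U}
    {H : N → EuclideanSpace ℝ (Fin n)} {a : EvenIndex q → EuclideanSpace ℝ (Fin n)}
    {L : EuclideanSpace ℝ (Fin n) →L[ℝ] ℝ}
    (hH : ∀ u : U, u.1.1 = x → ContMDiffAt (𝓡 n) 𝓘(ℝ, EuclideanSpace ℝ (Fin n)) ∞ H u.1.2)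
    (hξ : ∀ I, ∀ u : U, u.1.1 = x →
      mfderiv (𝓡 n) 𝓘(ℝ, EuclideanSpace ℝ (Fin n)) H u.1.2 ((ξ I).val u) = a I)
    (hg : ∀ u : U, u.1.1 = x → g u = L (H u.1.2)) :
    evalAt q x (graphExp φ U hU ξ g) = L (H (φ x)) • 1 + ∑ I, L (a I) • evenMonomial I := by
  rw [evalAt_graphExp_of_lie_lie φ hU x g fun I J u hu => (ξ I).apply_eq_zero_of_const
    (fun u hu => VertField.apply_eq_of_mfderiv hH (hξ J) hg hu) hu, hg _ rfl]
  congr 1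
  exact Finset.sum_congr rfl fun I _ =>
    congrArg (· • evenMonomial I) (VertField.apply_eq_of_mfderiv hH (hξ I) hg rfl)

end VertFields

/-! ### A global resolution of the identity of the tangent bundle -/

section Coframe

universe u

open scoped Topology

variable {n : ℕ} {N : Type u} [TopologicalSpace N] [ChartedSpace (EuclideanSpace ℝ (Fin n)) N]
  [IsManifold (𝓡 n) ∞ N]

theorem sum_eq_sum_of_eq_zero {ι A : Type*} [AddCommMonoid A] {f : ι → A} {S T : Finset ι}
    (hS : ∀ a ∉ S, f a = 0) (hT : ∀ a ∉ T, f a = 0) : ∑ a ∈ S, f a = ∑ a ∈ T, f a := by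
  classical
  rw [Finset.sum_subset (Finset.subset_union_left (s₂ := T)) fun a _ ha => hS a ha,
    Finset.sum_subset (Finset.subset_union_right (s₁ := S)) fun a _ ha => hT a ha]

theorem differentialAt_bump_smul_extChartAt {c z : N} (ρ : SmoothBumpFunction (𝓡 n) c)
    (hz : ρ =ᶠ[𝓝 z] 1) {F : C^∞⟮𝓡 n, N; ℝ⟯} {k : Fin n}
    (hF : ∀ p, F p = ρ p • (extChartAt (𝓡 n) c p) k) (v : TangentSpace (𝓡 n) z) :
    differentialAt z F v =
      (trivializationAt (EuclideanSpace ℝ (Fin n)) (TangentSpace (𝓡 n)) c ⟨z, v⟩).2 k := by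
  have hzs : z ∈ (chartAt (EuclideanSpace ℝ (Fin n)) c).source := by
    refine ρ.support_subset_source ?_
    rw [Function.mem_support, hz.self_of_nhds]
    exact one_ne_zero
  have hF' : F =ᶠ[𝓝 z] fun p => (EuclideanSpace.proj k : EuclideanSpace ℝ (Fin n) →L[ℝ] ℝ)
      (extChartAt (𝓡 n) c p) := by
    filter_upwards [hz] with p hp
    rw [hF, hp, Pi.one_apply, one_smul]
    rfl
  rw [trivializationAt_snd_eq_mfderiv hzs]
  change mfderiv (𝓡 n) 𝓘(ℝ, ℝ) F z v = _
  rw [hF'.mfderiv_eq]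
  exact mfderiv_clm_comp (EuclideanSpace.proj k) (contMDiffAt_extChartAt' hzs) v

/-- There are a locally finite family of vector fields `W` and a family of functions `F` with
`∑ a, dF a ⊗ W a` the identity of `TN`. -/
theorem exists_coframe [T2Space N] [SigmaCompactSpace N] :
    ∃ (ι : Type u) (F : ι → C^∞⟮𝓡 n, N; ℝ⟯) (W : ι → ∀ z : N, TangentSpace (𝓡 n) z),
      (∀ a, ContMDiff (𝓡 n) (𝓡 n).tangent ∞
        fun z => (⟨z, W a z⟩ : TangentBundle (𝓡 n) N)) ∧
      (∀ z₀, ∃ S : Finset ι, ∀ᶠ z in 𝓝 z₀, ∀ a ∉ S, W a z = 0) ∧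
      ∀ (z : N) (v : TangentSpace (𝓡 n) z) (S : Finset ι), (∀ a ∉ S, W a z = 0) →
        ∑ a ∈ S, differentialAt z (F a) v • W a z = v := by
  classical
  have : IsManifold (𝓡 n) 1 N := IsManifold.of_le (n := ∞) (by simp)
  obtain ⟨ι, f, -⟩ := SmoothBumpCovering.exists_isSubordinate (𝓡 n) (s := (Set.univ : Set N))
    isClosed_univ (U := fun _ => Set.univ) fun x _ => Filter.univ_mem
  -- The partition of unity is supported where the bump functions are locally 1, so that wherever `χ
  -- i` is nonzero the cut-off coordinates have the differentials of true coordinates.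
  let O : ι → Set N := fun i => {z | f i =ᶠ[𝓝 z] 1}
  obtain ⟨χ, hχ⟩ := SmoothPartitionOfUnity.exists_isSubordinate (𝓡 n) (isClosed_univ (X := N)) O
    (fun i => isOpen_setOfPred_eventually_nhds) fun z _ =>
      Set.mem_iUnion.2 ⟨_, f.eventuallyEq_one z (Set.mem_univ z)⟩
  let e : ∀ i, Bundle.Trivialization (EuclideanSpace ℝ (Fin n))
      (Bundle.TotalSpace.proj : TangentBundle (𝓡 n) N → N) := fun i =>
    trivializationAt (EuclideanSpace ℝ (Fin n)) (TangentSpace (𝓡 n)) (f.c i)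
  let b := (EuclideanSpace.basisFun (Fin n) ℝ).toBasis
  have hO : ∀ i, O i ⊆ (e i).baseSet := by
    intro i z hz
    refine (f i).support_subset_source ?_
    rw [Function.mem_support, Filter.EventuallyEq.eq_of_nhds hz]
    exact one_ne_zero
  let F : ι × Fin n → C^∞⟮𝓡 n, N; ℝ⟯ := fun a =>
    ⟨fun p => f a.1 p • (extChartAt (𝓡 n) (f.c a.1) p) a.2,
      (f a.1).contMDiff_smul ((EuclideanSpace.proj a.2 : EuclideanSpace ℝ (Fin n) →L[ℝ] ℝ).contDiff
        |>.contMDiff.comp_contMDiffOn contMDiffOn_extChartAt)⟩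
  let W : ι × Fin n → ∀ z : N, TangentSpace (𝓡 n) z := fun a =>
    (χ a.1 : N → ℝ) • (e a.1).localFrame b a.2
  have hWχ : ∀ a z, W a z = χ a.1 z • (e a.1).localFrame b a.2 z := fun _ _ => rfl
  have hWzero : ∀ (a : ι × Fin n) (z : N), χ a.1 z = 0 → W a z = 0 := fun a z h => by
    rw [hWχ, h, zero_smul]
  have hsum : ∀ (i : ι) (z : N) (v : TangentSpace (𝓡 n) z),
      ∑ k, differentialAt z (F (i, k)) v • W (i, k) z = χ i z • v := by
    intro i z v
    by_cases hz : χ i z = 0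
    · rw [hz, zero_smul]
      refine Finset.sum_eq_zero fun k _ => ?_
      rw [hWzero (i, k) z hz, smul_zero]
    have hzO : z ∈ O i := hχ i (subset_tsupport _ hz)
    have hv : v = ∑ k, differentialAt z (F (i, k)) v • (e i).localFrame b k z := by
      conv_lhs => rw [← ((e i).basisAt b (hO i hzO)).sum_repr v]
      refine Finset.sum_congr rfl fun k _ => ?_
      rw [Bundle.Trivialization.localFrame_apply_of_mem_baseSet (hx := hO i hzO),
        differentialAt_bump_smul_extChartAt (f i) hzO fun p => rfl]
      simp [Bundle.Trivialization.basisAt, b, e]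
    conv_rhs => rw [hv, Finset.smul_sum]
    exact Finset.sum_congr rfl fun k _ => by rw [hWχ, smul_comm]
  have hloc : ∀ z₀, ∃ S : Finset ι, ∀ᶠ z in 𝓝 z₀, ∀ i ∉ S, χ i z = 0 := by
    intro z₀
    refine ⟨χ.fintsupport z₀, ?_⟩
    filter_upwards [χ.eventually_finsupport_subset z₀] with z hz i hi
    by_contra h
    exact hi (hz ((χ.mem_finsupport z).2 h))
  refine ⟨ι × Fin n, F, W, fun a => ?_, fun z₀ => ?_, fun z v S hS => ?_⟩
  · exact ContMDiffOn.smul_section_of_tsupport (χ a.1).contMDiff.contMDiffOn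
      (e a.1).open_baseSet ((hχ a.1).trans (hO a.1))
      ((e a.1).contMDiffOn_localFrame_baseSet ∞ b a.2)
  · obtain ⟨S, hS⟩ := hloc z₀
    refine ⟨S ×ˢ Finset.univ, ?_⟩
    filter_upwards [hS] with z hz a ha
    exact hWzero a z (hz a.1 fun h => ha (Finset.mem_product.2 ⟨h, Finset.mem_univ _⟩))
  · obtain ⟨T, hT⟩ := hloc z
    have hT := hT.self_of_nhds
    have hW : ∀ a ∉ T ×ˢ (Finset.univ : Finset (Fin n)), W a z = 0 := fun a ha =>
      hWzero a z (hT a.1 fun h => ha (Finset.mem_product.2 ⟨h, Finset.mem_univ _⟩))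
    have h₁ : ∑ a ∈ S, differentialAt z (F a) v • W a z =
        ∑ a ∈ T ×ˢ (Finset.univ : Finset (Fin n)), differentialAt z (F a) v • W a z :=
      sum_eq_sum_of_eq_zero (fun a ha => by rw [hS a ha, smul_zero])
        fun a ha => by rw [hW a ha, smul_zero]
    rw [h₁, Finset.sum_product, Finset.sum_congr rfl fun i _ => hsum i z v, ← Finset.sum_smul,
      ← finsum_eq_sum_of_support_subset (fun i => χ i z), χ.sum_eq_one (Set.mem_univ z), one_smul]
    intro i hi
    by_contra h
    exact hi (hT i h)

end Coframe

/-! ### Construction of the fields on a neighbourhood of the whole graph -/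

section Global

open scoped Topology

variable {n : ℕ} {N ι : Type*} {W : ι → N → EuclideanSpace ℝ (Fin n)}

/-- The tangent vector at `z` with coefficients `k` in a family of vector fields; the tangent
space at `z` is identified with the model space. -/
def combination (W : ι → N → EuclideanSpace ℝ (Fin n)) (k : ι → ℝ) (z : N) :
    EuclideanSpace ℝ (Fin n) :=
  ∑ᶠ a, k a • W a z

theorem combination_eq_sum {z : N} {S : Finset ι} (hS : ∀ a ∉ S, W a z = 0) (k : ι → ℝ) :
    combination W k z = ∑ a ∈ S, k a • W a z := by
  refine finsum_eq_sum_of_support_subset _ fun a ha => ?_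
  by_contra h
  exact ha (by simp only [hS a h, smul_zero])

theorem combination_apply {z : N} {S : Finset ι} (hS : ∀ a ∉ S, W a z = 0) (k : ι → ℝ)
    (i : Fin n) :
    combination W k z i = ∑ a ∈ S, W a z i * k a := by
  rw [combination_eq_sum hS]
  simp [mul_comm]

variable [TopologicalSpace N] [ChartedSpace (EuclideanSpace ℝ (Fin n)) N]

/-- The derivative of a vector valued function, the tangent space being identified with the model
space. -/
def derivAt (f : N → EuclideanSpace ℝ (Fin n)) (p : N) :
    EuclideanSpace ℝ (Fin n) →L[ℝ] EuclideanSpace ℝ (Fin n) :=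
  mfderiv (𝓡 n) 𝓘(ℝ, EuclideanSpace ℝ (Fin n)) f p

/-- The components of `p ↦ ∑ a, F a p • W a z`, as smooth functions. -/
def component (W : ι → N → EuclideanSpace ℝ (Fin n)) (F : ι → C^∞⟮𝓡 n, N; ℝ⟯) (z : N)
    (S : Finset ι) (i : Fin n) : C^∞⟮𝓡 n, N; ℝ⟯ :=
  ∑ a ∈ S, W a z i • F a

theorem component_apply {F : ι → C^∞⟮𝓡 n, N; ℝ⟯} {z : N} {S : Finset ι}
    (hS : ∀ a ∉ S, W a z = 0) (i : Fin n) (p : N) :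
    component W F z S i p = combination W (fun a => F a p) z i := by
  rw [combination_apply hS]
  have h := map_sum (evalAlgHom (d := n) p) (fun a => W a z i • F a) S
  simp only [map_smul] at h
  exact h

theorem contMDiff_combination {F : ι → C^∞⟮𝓡 n, N; ℝ⟯} {z : N}
    (hW : ∃ S : Finset ι, ∀ a ∉ S, W a z = 0) :
    ContMDiff (𝓡 n) 𝓘(ℝ, EuclideanSpace ℝ (Fin n)) ∞
      fun p => combination W (fun a => F a p) z := by
  obtain ⟨S, hS⟩ := hW
  have h : ContMDiff (𝓡 n) 𝓘(ℝ, EuclideanSpace ℝ (Fin n)) ∞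
      fun p => ∑ a ∈ S, F a p • W a z :=
    contMDiff_finsetSum fun a _ => (F a).contMDiff.smul contMDiff_const
  simpa only [combination_eq_sum hS] using h

theorem differentialAt_component {F : ι → C^∞⟮𝓡 n, N; ℝ⟯} {z : N} {S : Finset ι}
    (hS : ∀ a ∉ S, W a z = 0) (i : Fin n) (p : N) (v : EuclideanSpace ℝ (Fin n)) :
    differentialAt p (component W F z S i) v =
      derivAt (fun p => combination W (fun a => F a p) z) p v i := by
  have h := mfderiv_clm_comp (EuclideanSpace.proj i : EuclideanSpace ℝ (Fin n) →L[ℝ] ℝ)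
    (contMDiff_combination ⟨S, hS⟩ (F := F) p) v
  refine Eq.trans ?_ h
  have hf : (component W F z S i : N → ℝ) = fun p => (EuclideanSpace.proj i :
      EuclideanSpace ℝ (Fin n) →L[ℝ] ℝ) (combination W (fun a => F a p) z) :=
    funext (component_apply hS i)
  change mfderiv (𝓡 n) 𝓘(ℝ, ℝ) (component W F z S i) p v = _
  rw [hf]

/-- This is the resolution of the identity itself. It makes the combination a local coordinate
system at `z`, with values in the tangent space there and no chart chosen. -/
theorem derivAt_combination_self {F : ι → C^∞⟮𝓡 n, N; ℝ⟯} {z : N} {S : Finset ι}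
    (hS : ∀ a ∉ S, W a z = 0)
    (hFW : ∀ v : EuclideanSpace ℝ (Fin n), ∑ a ∈ S, differentialAt z (F a) v • W a z = v) :
    derivAt (fun p => combination W (fun a => F a p) z) z = ContinuousLinearMap.id ℝ _ := by
  refine ContinuousLinearMap.ext fun v => PiLp.ext fun i => ?_
  refine (differentialAt_component hS i z v).symm.trans ?_
  conv_rhs => rw [ContinuousLinearMap.id_apply, ← hFW v]
  simp [component, map_sum, mul_comm]

section

variable [IsManifold (𝓡 n) ∞ N]

theorem contMDiffAt_derivAt_extChartAt_combination
    (hW : ∀ a, ContMDiff (𝓡 n) (𝓡 n).tangent ∞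
      fun z => (⟨z, W a z⟩ : TangentBundle (𝓡 n) N))
    (hloc : ∀ z₀, ∃ S : Finset ι, ∀ᶠ z in 𝓝 z₀, ∀ a ∉ S, W a z = 0)
    {E' H' : Type*} [NormedAddCommGroup E'] [NormedSpace ℝ E'] [TopologicalSpace H']
    {J : ModelWithCorners ℝ E' H'} {P : Type*} [TopologicalSpace P] [ChartedSpace H' P]
    {g : P → N} {u₀ : P} (hg : ContMDiffAt J (𝓡 n) ∞ g u₀)
    {k : P → ι → ℝ} (hk : ∀ a, ContMDiffAt J 𝓘(ℝ, ℝ) ∞ (fun u => k u a) u₀) :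
    ContMDiffAt J 𝓘(ℝ, EuclideanSpace ℝ (Fin n)) ∞
      (fun u => derivAt (extChartAt (𝓡 n) (g u₀)) (g u) (combination W (k u) (g u))) u₀ := by
  obtain ⟨S, hS⟩ := hloc (g u₀)
  have hw : ∀ a, ContMDiffAt J 𝓘(ℝ, EuclideanSpace ℝ (Fin n)) ∞ (fun u =>
      (trivializationAt (EuclideanSpace ℝ (Fin n)) (TangentSpace (𝓡 n)) (g u₀)
        ⟨g u, W a (g u)⟩).2) u₀ := by
    intro a
    have h := (Bundle.contMDiffAt_totalSpace.1 (hW a (g u₀))).2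
    exact h.comp u₀ hg
  have hsum : ContMDiffAt J 𝓘(ℝ, EuclideanSpace ℝ (Fin n)) ∞ (fun u => ∑ a ∈ S, k u a •
      (trivializationAt (EuclideanSpace ℝ (Fin n)) (TangentSpace (𝓡 n)) (g u₀)
        ⟨g u, W a (g u)⟩).2) u₀ :=
    contMDiffAt_finsetSum fun a _ => (hk a).smul (hw a)
  refine hsum.congr_of_eventuallyEq ?_
  filter_upwards [hg.continuousAt.eventually hS, hg.continuousAt.eventually
    ((chartAt (EuclideanSpace ℝ (Fin n)) (g u₀)).open_source.mem_nhds (mem_chart_source _ _))]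
    with u h₁ h₂
  rw [combination_eq_sum h₁, map_sum]
  refine Finset.sum_congr rfl fun a _ => ?_
  rw [map_smul]
  exact congrArg (k u a • ·) (trivializationAt_snd_eq_mfderiv h₂ (W a (g u))).symm

variable {m : ℕ} {Ω : Opens (EuclideanSpace ℝ (Fin m))}

theorem eventually_isInvertible_derivAt_extChartAt (φ : C^∞⟮𝓡 m, Ω; 𝓡 n, N⟯) (x₀ : Ω) :
    ∀ᶠ x in 𝓝 x₀, (derivAt (extChartAt (𝓡 n) (φ x₀)) (φ x)).IsInvertible := by
  filter_upwards [φ.contMDiff.continuous.continuousAt.eventually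
    ((chartAt (EuclideanSpace ℝ (Fin n)) (φ x₀)).open_source.mem_nhds
      (mem_chart_source _ _))] with x hx
  exact isInvertible_mfderiv_extChartAt_of_mem hx

theorem contMDiffAt_derivAt_extChartAt_combination_snd
    (hW : ∀ a, ContMDiff (𝓡 n) (𝓡 n).tangent ∞
      fun z => (⟨z, W a z⟩ : TangentBundle (𝓡 n) N))
    (hloc : ∀ z₀, ∃ S : Finset ι, ∀ᶠ z in 𝓝 z₀, ∀ a ∉ S, W a z = 0)
    (F : ι → C^∞⟮𝓡 n, N; ℝ⟯) (φ : C^∞⟮𝓡 m, Ω; 𝓡 n, N⟯) (x₀ : Ω) (p : N) :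
    ContMDiffAt ((𝓡 m).prod (𝓡 n)) 𝓘(ℝ, EuclideanSpace ℝ (Fin n)) ∞
      (fun z : Ω × N => derivAt (extChartAt (𝓡 n) (φ x₀)) (φ z.1)
        (combination W (fun a => F a z.2) (φ z.1))) (x₀, p) :=
  contMDiffAt_derivAt_extChartAt_combination (J := (𝓡 m).prod (𝓡 n)) (P := Ω × N)
    (g := fun z : Ω × N => φ z.1) (k := fun (z : Ω × N) a => F a z.2) hW hloc
    ((φ.contMDiff.comp contMDiff_fst) (x₀, p))
    fun a => ((F a).contMDiff.comp contMDiff_snd) (x₀, p)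

/-- Invertibility is an open condition, and the derivative is the identity on the graph. Openness is
applied after composing with the derivative of a fixed chart, which makes the family jointly smooth;
that factor is cancelled at the end. -/
theorem eventually_isInvertible_derivAt_combination
    (hW : ∀ a, ContMDiff (𝓡 n) (𝓡 n).tangent ∞
      fun z => (⟨z, W a z⟩ : TangentBundle (𝓡 n) N))
    (hloc : ∀ z₀, ∃ S : Finset ι, ∀ᶠ z in 𝓝 z₀, ∀ a ∉ S, W a z = 0)
    {F : ι → C^∞⟮𝓡 n, N; ℝ⟯}
    (hFW : ∀ (z : N) (v : EuclideanSpace ℝ (Fin n)) (S : Finset ι), (∀ a ∉ S, W a z = 0) →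
      ∑ a ∈ S, differentialAt z (F a) v • W a z = v)
    (φ : C^∞⟮𝓡 m, Ω; 𝓡 n, N⟯) (x₀ : Ω) :
    ∀ᶠ u : Ω × N in 𝓝 (x₀, φ x₀),
      (derivAt (fun p => combination W (fun a => F a p) (φ u.1)) u.2).IsInvertible := by
  have hloc' : ∀ z, ∃ S : Finset ι, ∀ a ∉ S, W a z = 0 := fun z =>
    (hloc z).imp fun S hS => hS.self_of_nhds
  have hder : ∀ u : Ω × N, derivAt (fun p => derivAt (extChartAt (𝓡 n) (φ x₀)) (φ u.1)
      (combination W (fun a => F a p) (φ u.1))) u.2 =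
      (derivAt (extChartAt (𝓡 n) (φ x₀)) (φ u.1)).comp
        (derivAt (fun p => combination W (fun a => F a p) (φ u.1)) u.2) := fun u =>
    ContinuousLinearMap.ext (mfderiv_clm_comp _ (contMDiff_combination (hloc' (φ u.1)) u.2))
  have hinv : (derivAt (fun p => derivAt (extChartAt (𝓡 n) (φ x₀)) (φ x₀)
      (combination W (fun a => F a p) (φ x₀))) (φ x₀)).IsInvertible := by
    obtain ⟨S, hS⟩ := hloc' (φ x₀)
    rw [hder (x₀, φ x₀), derivAt_combination_self hS fun v => hFW _ v S hS]
    exact (eventually_isInvertible_derivAt_extChartAt φ x₀).self_of_nhds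
  have h := eventually_isInvertible_mfderiv (J := (𝓡 m).prod (𝓡 n)) (P := Ω × N)
    (g := fun u : Ω × N => u.2) (u₀ := (x₀, φ x₀))
    (H := fun (u : Ω × N) p => derivAt (extChartAt (𝓡 n) (φ x₀)) (φ u.1)
      (combination W (fun a => F a p) (φ u.1))) contMDiffAt_snd
    (ContMDiffAt.comp (f := fun w : (Ω × N) × N => (w.1.1, w.2)) ((x₀, φ x₀), φ x₀)
      (contMDiffAt_derivAt_extChartAt_combination_snd hW hloc F φ x₀ (φ x₀))
      (((contMDiff_fst.comp contMDiff_fst).prodMk contMDiff_snd) _)) hinv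
  filter_upwards [h, continuousAt_fst.eventually
    (eventually_isInvertible_derivAt_extChartAt φ x₀)] with u h₁ h₂
  replace h₁ : (derivAt (fun p => derivAt (extChartAt (𝓡 n) (φ x₀)) (φ u.1)
      (combination W (fun a => F a p) (φ u.1))) u.2).IsInvertible := h₁
  rw [hder] at h₁
  obtain ⟨e, he⟩ := h₂
  rw [← he] at h₁
  exact ContinuousLinearMap.isInvertible_equiv_comp.1 h₁

variable [T2Space N] {q : ℕ}

/-- Rigidity at `φ x`, tested on the components of the coordinates attached to `φ x`. With `x`
frozen these are finite real combinations of the `F a`, so linearity determines `Φ` on them. -/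
theorem evalAt_eq_graphExp_of_coframe {Φ : C^∞⟮𝓡 n, N; ℝ⟯ →ₐ[ℝ] EvenSuperFun Ω q}
    {φ : C^∞⟮𝓡 m, Ω; 𝓡 n, N⟯} (hφ : ∀ f x, body Ω q (Φ f) x = f (φ x))
    {F : ι → C^∞⟮𝓡 n, N; ℝ⟯} {b : ι → EvenIndex q → C^∞⟮𝓡 m, Ω; ℝ⟯}
    (hb : ∀ a, Φ (F a) = body Ω q (Φ (F a)) ⊗ₜ 1 + ∑ I, b a I ⊗ₜ evenMonomial I)
    {U : Opens (Ω × N)} {hU : ∀ x : Ω, (x, φ x) ∈ U} {ξ : EvenIndex q → VertField (n := n) U}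
    {x : Ω} {S : Finset ι} (hS : ∀ a ∉ S, W a (φ x) = 0)
    (hFW : ∀ v : EuclideanSpace ℝ (Fin n), ∑ a ∈ S, differentialAt (φ x) (F a) v • W a (φ x) = v)
    (hξ : ∀ I (u : U), u.1.1 = x →
      derivAt (fun p => combination W (fun a => F a p) (φ x)) u.1.2 ((ξ I).val u) =
        combination W (fun a => b a I x) (φ x)) (f : C^∞⟮𝓡 n, N; ℝ⟯) :
    evalAt q x (Φ f) = evalAt q x (graphExp φ U hU ξ (projPullback U f)) := by
  have key : (evalAt q x).comp Φ =
      (evalAt q x).comp ((graphExp φ U hU ξ).comp (projPullback U)) := by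
    refine algHom_eq_of_augmentation (p := φ x)
      (fun f => (body_apply (Φ f) x).symm.trans (hφ f x))
      (fun f => augmentation_evalAt_graphExp φ hU x (projPullback U f))
      (component W F (φ x) S) (fun i => ?_) fun v hv => ?_
    · have h₂ := evalAt_graphExp_of_mfderiv (q := q) (ξ := ξ) φ hU (x := x)
        (g := projPullback U (component W F (φ x) S i))
        (H := fun p => combination W (fun a => F a p) (φ x))
        (a := fun I => combination W (fun a => b a I x) (φ x))
        (L := EuclideanSpace.proj i) (fun u _ => contMDiff_combination ⟨S, hS⟩ u.1.2) hξ
        (fun u _ => component_apply hS i u.1.2)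
      refine Eq.trans ?_ h₂.symm
      have h₁ : ∀ a, evalAt q x (Φ (F a)) =
          F a (φ x) • 1 + ∑ I, b a I x • evenMonomial I := by
        intro a
        conv_lhs => rw [hb a]
        simp only [map_add, map_sum, evalAt_tmul, hφ]
      change evalAt q x (Φ (∑ a ∈ S, _)) = combination W _ (φ x) i • 1 +
        ∑ I, combination W _ (φ x) i • _
      simp only [map_sum, map_smul, h₁, combination_apply hS, smul_add, Finset.sum_add_distrib,
        Finset.sum_smul, Finset.smul_sum, smul_smul]
      congr 1
      exact Finset.sum_comm
    · refine PiLp.ext fun i => ?_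
      have h := hv i
      rw [differentialAt_component hS, derivAt_combination_self hS hFW] at h
      exact h
  exact DFunLike.congr_fun key f

theorem exists_graphExp_eq [SigmaCompactSpace N] (Φ : C^∞⟮𝓡 n, N; ℝ⟯ →ₐ[ℝ] EvenSuperFun Ω q)
    (φ : C^∞⟮𝓡 m, Ω; 𝓡 n, N⟯) (hφ : ∀ f x, body Ω q (Φ f) x = f (φ x))
    {O : Set (Ω × N)} (hO : IsOpen O) (hφO : ∀ x, (x, φ x) ∈ O) :
    ∃ (U : Opens (Ω × N)) (hU : ∀ x : Ω, (x, φ x) ∈ U)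
      (ξ : EvenIndex q → VertField (n := n) U), (∀ u ∈ U, u ∈ O) ∧
        (∀ f, Φ f = graphExp φ U hU ξ (projPullback U f)) ∧
        (∀ I J, (ξ I).Commutes (ξ J)) := by
  obtain ⟨ι, F, W, hW, hloc, hFW⟩ : ∃ (ι : Type _) (F : ι → C^∞⟮𝓡 n, N; ℝ⟯)
      (W : ι → N → EuclideanSpace ℝ (Fin n)),
      (∀ a, ContMDiff (𝓡 n) (𝓡 n).tangent ∞
        fun z => (⟨z, W a z⟩ : TangentBundle (𝓡 n) N)) ∧
      (∀ z₀, ∃ S : Finset ι, ∀ᶠ z in 𝓝 z₀, ∀ a ∉ S, W a z = 0) ∧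
      ∀ (z : N) (v : EuclideanSpace ℝ (Fin n)) (S : Finset ι), (∀ a ∉ S, W a z = 0) →
        ∑ a ∈ S, differentialAt z (F a) v • W a z = v := exists_coframe
  have hloc' : ∀ z, ∃ S : Finset ι, ∀ a ∉ S, W a z = 0 := fun z =>
    (hloc z).imp fun S hS => hS.self_of_nhds
  choose b hb using fun a => exists_coefficients (Φ (F a))
  let D : Set (Ω × N) :=
    {u | (derivAt (fun p => combination W (fun a => F a p) (φ u.1)) u.2).IsInvertible}
  let U : Opens (Ω × N) := ⟨interior D ∩ O, isOpen_interior.inter hO⟩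
  have hU : ∀ x : Ω, (x, φ x) ∈ U := fun x => ⟨mem_interior_iff_mem_nhds.2
    (eventually_isInvertible_derivAt_combination hW hloc hFW φ x), hφO x⟩
  have hinv : ∀ u ∈ U,
      (derivAt (fun p => combination W (fun a => F a p) (φ u.1)) u.2).IsInvertible :=
    fun u hu => interior_subset (s := D) hu.1
  have hH : ∀ u ∈ U, ContMDiffAt (𝓡 n) 𝓘(ℝ, EuclideanSpace ℝ (Fin n)) ∞
      (fun p => combination W (fun a => F a p) (φ u.1)) u.2 :=
    fun u _ => contMDiff_combination (hloc' (φ u.1)) u.2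
  obtain ⟨ξ, hξ⟩ := exists_vertFields_of_mfderiv (U := U)
    (H := fun x p => combination W (fun a => F a p) (φ x))
    -- The `η^I` coefficients of `Φ (F a)`, assembled into a vector tangent at `φ x`.
    (c := fun I x => combination W (fun a => b a I x) (φ x)) hH hinv fun x₀ =>
      ⟨fun x => derivAt (extChartAt (𝓡 n) (φ x₀)) (φ x),
        (eventually_isInvertible_derivAt_extChartAt φ x₀).self_of_nhds,
        fun p _ => contMDiffAt_derivAt_extChartAt_combination_snd hW hloc F φ x₀ p,
        fun I => contMDiffAt_derivAt_extChartAt_combination (J := 𝓡 m) (P := Ω)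
          (g := fun x : Ω => φ x) (k := fun x a => b a I x) hW hloc (φ.contMDiff x₀)
          fun a => (b a I).contMDiff x₀⟩
  refine ⟨U, hU, ξ, fun u hu => hu.2, fun f => superFun_ext fun x => ?_, fun I J =>
    VertField.commutes_of_mfderiv
      (H := fun x p => combination W (fun a => F a p) (φ x))
      (a := fun x => combination W (fun a => b a I x) (φ x))
      (b := fun x => combination W (fun a => b a J x) (φ x)) hH hinv (hξ I) (hξ J)⟩
  obtain ⟨S, hS⟩ := hloc' (φ x)
  exact evalAt_eq_graphExp_of_coframe hφ hb hS (fun v => hFW _ v S hS)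
    (fun I u hu => by rw [← hu]; exact hξ I u) f

end

end Global

/-! ### Fields constant in the coordinates of a single chart -/

section Chart

open scoped Topology

variable {m n q : ℕ} {N : Type*} [TopologicalSpace N] [ChartedSpace (EuclideanSpace ℝ (Fin n)) N]
  {Ω : Opens (EuclideanSpace ℝ (Fin m))} {U : Opens (Ω × N)}

theorem isInvertible_mfderiv_of_mem_maximalAtlas
    {y : OpenPartialHomeomorph N (EuclideanSpace ℝ (Fin n))}
    (hy : y ∈ IsManifold.maximalAtlas (𝓡 n) ∞ N) {p : N} (hp : p ∈ y.source) :
    (mfderiv (𝓡 n) 𝓘(ℝ, EuclideanSpace ℝ (Fin n)) y p).IsInvertible := by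
  have h : y.MDifferentiable (𝓡 n) (𝓡 n) :=
    ⟨(contMDiffOn_of_mem_maximalAtlas hy).mdifferentiableOn (by simp),
      (contMDiffOn_symm_of_mem_maximalAtlas hy).mdifferentiableOn (by simp)⟩
  exact ⟨h.mfderiv hp, rfl⟩

variable [IsManifold (𝓡 n) ∞ N] [T2Space N]

theorem exists_contMDiffMap_eventually_eq_chart
    {y : OpenPartialHomeomorph N (EuclideanSpace ℝ (Fin n))}
    (hy : y ∈ IsManifold.maximalAtlas (𝓡 n) ∞ N) {p : N} (hp : p ∈ y.source) (i : Fin n) :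
    ∃ g : C^∞⟮𝓡 n, N; ℝ⟯, ∀ᶠ z in 𝓝 p, g z = y z i := by
  obtain ⟨ρ, hρ, -⟩ := (SmoothBumpFunction.nhds_basis_support (I := 𝓡 n)
    (y.open_source.mem_nhds hp)).mem_iff.1 (Filter.univ_mem (f := 𝓝 p))
  have hsmooth : ContMDiff (𝓡 n) 𝓘(ℝ, ℝ) ∞ fun z => ρ z • y z i := by
    refine contMDiff_of_tsupport fun z hz => ?_
    have hz : z ∈ y.source := hρ (tsupport_smul_subset_left _ _ hz)
    exact ρ.contMDiff.contMDiffAt.smul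
      (((EuclideanSpace.proj i : EuclideanSpace ℝ (Fin n) →L[ℝ] ℝ).contDiff.contMDiff
        |>.contMDiffAt).comp z
        ((contMDiffOn_of_mem_maximalAtlas hy).contMDiffAt (y.open_source.mem_nhds hz)))
  refine ⟨⟨_, hsmooth⟩, ?_⟩
  filter_upwards [ρ.eventuallyEq_one] with z hz
  change ρ z • y z i = _
  rw [hz, Pi.one_apply, one_smul]

theorem evalAt_graphExp_eq_of_eventually_eq (φ : C^∞⟮𝓡 m, Ω; 𝓡 n, N⟯)
    (hU : ∀ x : Ω, (x, φ x) ∈ U) (ξ : EvenIndex q → VertField (n := n) U) {x : Ω}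
    {f : C^∞⟮𝓡 n, N; ℝ⟯} {g : SmoothFun (n := n) U}
    (hfg : ∀ᶠ p in 𝓝 (φ x), ∀ u : U, u.1.2 = p → f p = g u) :
    evalAt q x (graphExp φ U hU ξ (projPullback U f)) = evalAt q x (graphExp φ U hU ξ g) := by
  obtain ⟨ρ, hρ, -⟩ := (SmoothBumpFunction.nhds_basis_support (I := 𝓡 n) hfg).mem_iff.1
    (Filter.univ_mem (f := 𝓝 (φ x)))
  refine apply_eq_of_forall_mul_eq ((evalAt q x).comp (graphExp φ U hU ξ))
    (h := projPullback U (1 - ⟨ρ, ρ.contMDiff⟩)) ?_ ?_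
  · refine (augmentation_evalAt_graphExp φ hU x _).trans ?_
    change 1 - ρ (φ x) = 0
    rw [ρ.eq_one, sub_self]
  · ext u
    change f u.1.2 - g u = (1 - ρ u.1.2) * (f u.1.2 - g u)
    by_cases hu : u.1.2 ∈ tsupport ρ
    · rw [show f u.1.2 = g u from hρ hu u rfl, sub_self, mul_zero]
    · rw [image_eq_zero_of_notMem_tsupport hu, sub_zero, one_mul]

/-- A coordinate function of a chart, on an open set above the domain of the chart. -/
def chartFun {y : OpenPartialHomeomorph N (EuclideanSpace ℝ (Fin n))}
    (hy : y ∈ IsManifold.maximalAtlas (𝓡 n) ∞ N) (hUy : ∀ u ∈ U, u.2 ∈ y.source) (i : Fin n) :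
    SmoothFun (n := n) U :=
  ⟨fun u => y u.1.2 i, fun u =>
    ((EuclideanSpace.proj i : EuclideanSpace ℝ (Fin n) →L[ℝ] ℝ).contDiff.contMDiff
      |>.contMDiffAt).comp u (ContMDiffAt.comp (f := fun u : U => u.1.2) u
        ((contMDiffOn_of_mem_maximalAtlas hy).contMDiffAt (y.open_source.mem_nhds (hUy u.1 u.2)))
        ((contMDiff_snd.comp contMDiff_subtype_val) u))⟩

/-- Rigidity needs functions on all of `N`, while the coordinates live only on the chart domain;
cut-off coordinates with the same germs at `φ x` take their place. -/
theorem evalAt_graphExp_eq_of_chartFun {φ : C^∞⟮𝓡 m, Ω; 𝓡 n, N⟯}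
    {hU : ∀ x : Ω, (x, φ x) ∈ U} {ξ ζ : EvenIndex q → VertField (n := n) U}
    {y : OpenPartialHomeomorph N (EuclideanSpace ℝ (Fin n))}
    (hy : y ∈ IsManifold.maximalAtlas (𝓡 n) ∞ N) (hUy : ∀ u ∈ U, u.2 ∈ y.source) {x : Ω}
    (h : ∀ i, evalAt q x (graphExp φ U hU ξ (chartFun hy hUy i)) =
      evalAt q x (graphExp φ U hU ζ (chartFun hy hUy i))) (f : C^∞⟮𝓡 n, N; ℝ⟯) :
    evalAt q x (graphExp φ U hU ξ (projPullback U f)) =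
      evalAt q x (graphExp φ U hU ζ (projPullback U f)) := by
  have hφ : φ x ∈ y.source := hUy _ (hU x)
  choose g hg using exists_contMDiffMap_eventually_eq_chart hy hφ
  have hloc : ∀ (ξ : EvenIndex q → VertField (n := n) U) i,
      evalAt q x (graphExp φ U hU ξ (projPullback U (g i))) =
        evalAt q x (graphExp φ U hU ξ (chartFun hy hUy i)) := by
    intro ξ i
    refine evalAt_graphExp_eq_of_eventually_eq φ hU ξ ?_
    filter_upwards [hg i] with p hp u hu
    rw [hp, ← hu]
    rfl
  have key : (evalAt q x).comp ((graphExp φ U hU ξ).comp (projPullback U)) =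
      (evalAt q x).comp ((graphExp φ U hU ζ).comp (projPullback U)) := by
    refine algHom_eq_of_augmentation (p := φ x)
      (fun f => augmentation_evalAt_graphExp φ hU x (projPullback U f))
      (fun f => augmentation_evalAt_graphExp φ hU x (projPullback U f)) g
      (fun i => (hloc ξ i).trans ((h i).trans (hloc ζ i).symm)) fun v hv => ?_
    obtain ⟨e, he⟩ := isInvertible_mfderiv_of_mem_maximalAtlas hy hφ
    refine e.injective (Eq.trans (PiLp.ext fun i => ?_) (map_zero e).symm)
    refine Eq.trans ?_ (hv i)
    have h₁ : differentialAt (φ x) (g i) v =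
        mfderiv (𝓡 n) 𝓘(ℝ, ℝ) (fun z => (EuclideanSpace.proj i :
          EuclideanSpace ℝ (Fin n) →L[ℝ] ℝ) (y z)) (φ x) v := by
      change mfderiv (𝓡 n) 𝓘(ℝ, ℝ) (g i) (φ x) v = _
      rw [Filter.EventuallyEq.mfderiv_eq (hg i)]
      rfl
    rw [h₁]
    refine Eq.trans ?_ (mfderiv_clm_comp _ ((contMDiffOn_of_mem_maximalAtlas hy).contMDiffAt
      (y.open_source.mem_nhds hφ)) v).symm
    rw [← he]
    rfl
  exact DFunLike.congr_fun key f

theorem exists_graphExp_eq_of_chart [SigmaCompactSpace N]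
    (Φ : C^∞⟮𝓡 n, N; ℝ⟯ →ₐ[ℝ] EvenSuperFun Ω q)
    (φ : C^∞⟮𝓡 m, Ω; 𝓡 n, N⟯) (hφ : ∀ f x, body Ω q (Φ f) x = f (φ x))
    {y : OpenPartialHomeomorph N (EuclideanSpace ℝ (Fin n))}
    (hy : y ∈ IsManifold.maximalAtlas (𝓡 n) ∞ N) (hφy : ∀ x : Ω, φ x ∈ y.source) :
    ∃ (U : Opens (Ω × N)) (hU : ∀ x : Ω, (x, φ x) ∈ U)
      (ξ : EvenIndex q → VertField (n := n) U), (∀ u ∈ U, u.2 ∈ y.source) ∧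
        (∀ f, Φ f = graphExp φ U hU ξ (projPullback U f)) ∧
        (∀ I J, (ξ I).Commutes (ξ J)) ∧
        ∀ (I J) (i : Fin n) (u : U),
          (ξ I).apply ((ξ J).apply (fun v : U => y v.1.2 i)) u = 0 := by
  -- These fields serve to extend `Φ` to functions on `U`, which gives the coordinates `y^i` an
  -- image; their commutation is discarded.
  obtain ⟨U, hU, ξ, hUy, hξ, -⟩ := exists_graphExp_eq Φ φ hφ
    (O := {u | u.2 ∈ y.source}) (y.open_source.preimage continuous_snd) hφy
  choose β hβ using fun i => exists_coefficients (graphExp φ U hU ξ (chartFun hy hUy i))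
  have hH : ∀ u ∈ U, ContMDiffAt (𝓡 n) 𝓘(ℝ, EuclideanSpace ℝ (Fin n)) ∞ y u.2 := fun u hu =>
    (contMDiffOn_of_mem_maximalAtlas hy).contMDiffAt (y.open_source.mem_nhds (hUy u hu))
  have hinv : ∀ u ∈ U, (mfderiv (𝓡 n) 𝓘(ℝ, EuclideanSpace ℝ (Fin n)) y u.2).IsInvertible :=
    fun u hu => isInvertible_mfderiv_of_mem_maximalAtlas hy (hUy u hu)
  -- Since `y` does not depend on `x` and is jointly smooth, `τ` can be the identity.
  obtain ⟨ζ, hζ⟩ := exists_vertFields_of_mfderiv (U := U) (H := fun _ => y)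
    (c := fun I x => WithLp.toLp 2 fun i => β i I x) hH hinv fun x₀ =>
      ⟨fun _ => ContinuousLinearMap.id ℝ _,
        ⟨ContinuousLinearEquiv.refl ℝ _, rfl⟩,
        fun p hp => ContMDiffAt.comp (f := fun z : Ω × N => z.2) (x₀, p) (hH (x₀, p) hp)
          contMDiffAt_snd,
        fun I => (PiLp.continuousLinearEquiv 2 ℝ fun _ : Fin n => ℝ).symm.contDiff.contMDiff
          |>.contMDiffAt.comp x₀ (contMDiffAt_pi_space.2 fun i => (β i I).contMDiff x₀)⟩
  refine ⟨U, hU, ζ, hUy, fun f => ?_, fun I J => VertField.commutes_of_mfderiv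
    (H := fun _ => y) (a := fun x => WithLp.toLp 2 fun i => β i I x)
    (b := fun x => WithLp.toLp 2 fun i => β i J x) hH hinv (hζ I) (hζ J),
    fun I J i u => (ζ I).apply_eq_zero_of_const (x := u.1.1) (a := β i J u.1.1)
      (fun w hw => ?_) rfl⟩
  · refine (hξ f).trans (superFun_ext fun x => evalAt_graphExp_eq_of_chartFun hy hUy
      (fun i => ?_) f)
    have h := evalAt_graphExp_of_mfderiv (q := q) (ξ := ζ) φ hU (x := x)
      (g := chartFun hy hUy i) (H := y) (a := fun I => WithLp.toLp 2 fun i => β i I x)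
      (L := EuclideanSpace.proj i) (fun u _ => hH u.1 u.2)
      (fun I u hu => by rw [← hu]; exact hζ I u) (fun u _ => rfl)
    refine Eq.trans ?_ h.symm
    conv_lhs => rw [hβ i]
    simp only [map_add, map_sum, evalAt_tmul, body_apply, augmentation_evalAt_graphExp]
    rfl
  · exact VertField.apply_eq_of_mfderiv (H := y) (a := WithLp.toLp 2 fun i => β i J u.1.1)
      (L := EuclideanSpace.proj i) (fun u _ => hH u.1 u.2)
      (fun v hv => by rw [← hv]; exact hζ J v) (fun u _ => rfl) hw

end Chart

end SuperMap

end
theorem theorem1 {m n : ℕ} (q : ℕ) (Ω : TopologicalSpace.Opens (EuclideanSpace ℝ (Fin m)))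
    (N : Type*) [TopologicalSpace N] [T2Space N] [SecondCountableTopology N]
    [ChartedSpace (EuclideanSpace ℝ (Fin n)) N] [IsManifold (𝓡 n) ∞ N] :
    (∀ (φ : C^∞⟮𝓡 m, Ω; 𝓡 n, N⟯) (U : TopologicalSpace.Opens (Ω × N))
        (hU : ∀ x : Ω, (x, φ x) ∈ U)
        (ξ : SuperMap.EvenIndex q → SuperMap.VertField (n := n) U),
      ∃ Φ : C^∞⟮𝓡 n, N; ℝ⟯ →ₐ[ℝ] SuperMap.EvenSuperFun Ω q,
        ∀ f, Φ f = SuperMap.pullbackExp φ U hU ξ f) ∧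
    (∀ Φ : C^∞⟮𝓡 n, N; ℝ⟯ →ₐ[ℝ] SuperMap.EvenSuperFun Ω q,
      ∃ φ : C^∞⟮𝓡 m, Ω; 𝓡 n, N⟯,
        (∃ (U : TopologicalSpace.Opens (Ω × N)) (hU : ∀ x : Ω, (x, φ x) ∈ U)
            (ξ : SuperMap.EvenIndex q → SuperMap.VertField (n := n) U),
          (∀ f, Φ f = SuperMap.pullbackExp φ U hU ξ f) ∧
          (∀ I J, (ξ I).Commutes (ξ J))) ∧
        (∀ y ∈ IsManifold.maximalAtlas (𝓡 n) ∞ N, (∀ x : Ω, φ x ∈ y.source) →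
          ∃ (U : TopologicalSpace.Opens (Ω × N)) (hU : ∀ x : Ω, (x, φ x) ∈ U)
            (ξ : SuperMap.EvenIndex q → SuperMap.VertField (n := n) U),
          (∀ u ∈ U, u.2 ∈ y.source) ∧
          (∀ f, Φ f = SuperMap.pullbackExp φ U hU ξ f) ∧
          (∀ I J, (ξ I).Commutes (ξ J)) ∧
          (∀ (I J) (i : Fin n) (u : U),
            (ξ I).apply ((ξ J).apply (fun v : U => y v.1.2 i)) u = 0))) := by
  -- With second countability this yields the σ-compactness required by the existence lemmas.
  have : LocallyCompactSpace N := Manifold.locallyCompact_of_finiteDimensional (𝓡 n)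
  refine ⟨fun φ U hU ξ => ⟨(SuperMap.graphExp φ U hU ξ).comp (SuperMap.projPullback U),
    SuperMap.graphExp_projPullback ξ φ hU⟩, fun Φ => ?_⟩
  obtain ⟨φ, hφ⟩ := SuperMap.exists_underlying_map Φ
  refine ⟨φ, ?_, fun y hy hφy => SuperMap.exists_graphExp_eq_of_chart Φ φ hφ hy hφy⟩
  obtain ⟨U, hU, ξ, -, hξ, hc⟩ :=
    SuperMap.exists_graphExp_eq Φ φ hφ isOpen_univ fun x => Set.mem_univ _
  exact ⟨U, hU, ξ, hξ, hc⟩
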